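/- Let $\mathbb H$ be the quaternions, $\mathbb S=\{I\in\mathbb H:\ \operatorname{Re} I=0,\ \|I\|=1\}$, and $\mathbb C_I=\{x+Iy:\ x,y\in\mathbb R\}$ for $I\in\mathbb S$; let $\overline{\mathbb H}$ and $\overline{\mathbb C_I}$ denote the one-point compactifications. A set $U\subseteq\mathbb H$ is axially symmetric if $x+Iy\in U$ with $x,y\in\mathbb R$, $I\in\mathbb S$ implies $x+Jy\in U$ for all $J\in\mathbb S$. A real differentiable function $f:U\to\mathbb H$ on an open set $U$ is slice regular if $\frac12\left(\frac{\partial}{\partial x}+I\frac{\partial}{\partial y}\right)f(x+Iy)=0$ for all $I\in\mathbb S$ and all $x+Iy\in U\cap\mathbb C_I$. A polynomial is a function $q\mapsto\sum_{k=0}^n q^k a_k$ with $a_k\in\mathbb H$. Let $\Sigma\subseteq\mathbb H$ be a bounded region (non-empty, open and connected) which is a Jordan region in the sense that, for every $I\in\mathbb S$, $\Sigma\cap\mathbb C_I$ is a domain of the plane $\mathbb C_I$ whose boundary in $\mathbb C_I$ is a Jordan curve. Suppose that $\Sigma$ is starlike with respect to some real point $x_0$ (for every $q\in\Sigma$ the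 segment from $x_0$ to $q$ lies in $\Sigma$), that $\overline\Sigma$ is axially symmetric, that $\overline{\mathbb H}\setminus\overline\Sigma$ is connected, and that $\overline{\mathbb C_I}\setminus(\overline\Sigma\cap\mathbb C_I)$ is connected for all $I\in\mathbb S$. Let $\alpha\in\overline\Sigma$, and let $f:\overline\Sigma\to\mathbb H$ be continuous on $\overline\Sigma$ and slice regular in $\Sigma$. Then for every $\varepsilon>0$ there is a polynomial $P$ with $\|f(q)-P(q)\|<\varepsilon$ for all $q\in\overline\Sigma$ and $P(\alpha)=f(\alpha)$. -/

import Mathlib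

open scoped Quaternion

noncomputable section

/-- The unit sphere of purely imaginary quaternions. -/
def imagUnitSphere : Set ℍ[ℝ] := {I | I.re = 0 ∧ ‖I‖ = 1}

/-- The quaternion `x + I y`. -/
def slicePoint (I : ℍ[ℝ]) (x y : ℝ) : ℍ[ℝ] := (x : ℍ[ℝ]) + I * (y : ℍ[ℝ])

/-- The intersection `U ∩ ℂ_I`, where the plane `ℂ_I = {x + I y}` is identified with `ℂ`
through `x + i y ↦ x + I y` (an isometry for `I` in the unit sphere of imaginary quaternions). -/
def sliceSet (U : Set ℍ[ℝ]) (I : ℍ[ℝ]) : Set ℂ := {z | slicePoint I z.re z.im ∈ U}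

/-- Axial symmetry: with `x + I y` the set contains all `x + J y`. -/
def IsAxiallySymmetric (U : Set ℍ[ℝ]) : Prop :=
  ∀ x y : ℝ, ∀ I ∈ imagUnitSphere, slicePoint I x y ∈ U →
    ∀ J ∈ imagUnitSphere, slicePoint J x y ∈ U

/-- The Cauchy-Riemann operator `½ (∂/∂x + I ∂/∂y)` of the restriction of `f` to `ℂ_I`,
at the point `x + I y`. -/
def sliceDbar (f : ℍ[ℝ] → ℍ[ℝ]) (I : ℍ[ℝ]) (x y : ℝ) : ℍ[ℝ] :=
  (1 / 2 : ℝ) • (deriv (fun s : ℝ => f (slicePoint I s y)) x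
    + I * deriv (fun t : ℝ => f (slicePoint I x t)) y)

/-- Slice regularity on an open set `U`: `f` is real differentiable on `U` and
its restriction to every plane `ℂ_I` is annihilated by the Cauchy-Riemann operator. -/
def IsSliceRegularOn (f : ℍ[ℝ] → ℍ[ℝ]) (U : Set ℍ[ℝ]) : Prop :=
  DifferentiableOn ℝ f U ∧
    ∀ I ∈ imagUnitSphere, ∀ x y : ℝ, slicePoint I x y ∈ U → sliceDbar f I x y = 0

/-- Polynomial functions `q ↦ ∑ q ^ k a_k`, with quaternionic coefficients on the right. -/
def IsRightPolynomial (P : ℍ[ℝ] → ℍ[ℝ]) : Prop :=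
  ∃ (n : ℕ) (a : ℕ → ℍ[ℝ]), ∀ q, P q = ∑ k ∈ Finset.range (n + 1), q ^ k * a k

/-- A bounded Jordan region of the plane: a bounded domain whose boundary is a Jordan curve,
that is, the image of a continuous injective map of the circle. -/
def IsBoundedJordanRegion (G : Set ℂ) : Prop :=
  IsOpen G ∧ IsConnected G ∧ Bornology.IsBounded G ∧
    ∃ γ : Circle → ℂ, Continuous γ ∧ Function.Injective γ ∧ Set.range γ = frontier G

/-- The complement of `K` in the one-point compactification of `X`. -/
def extendedCompl {X : Type*} (K : Set X) : Set (OnePoint X) := ((↑) '' K)ᶜ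

end

/-! The problem reduces to one plane `ℂ_I`. A slice regular function is determined by its values on
`ℂ_I` through the representation formula `f(x + Jy) = ½((1 - JI) f(x + Iy) + (1 + JI) f(x - Iy))`,
which right polynomials satisfy as well. Since `‖1 ± JI‖ ≤ 2`, uniform approximation on `ℂ_I` gives
uniform approximation on the closure of `Ω`, with at most twice the error. Adding a small constant
then corrects the value at `α`.

Only the closure of `Ω` is axially symmetric, so `Ω ∩ ℂ_I` may vary with `I` and may fail to be
dense in the slice of the closure. A Baire argument (`dense_closure_sliceSet_eq`) shows that it is
dense there for a dense set of `I`. The representation formula is first proved for such planes by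
the identity theorem, then extended by continuity in `J` (`representation`).

For one such `I`, the slice `K` of the closure is compact and star-shaped. The Jordan curve
hypothesis excludes boundary slits, so the interior of `K` lies in `Ω`
(`StarConvex.interior_closure_subset`). The complex coordinates of `f` for left multiplication by
`I` are thus continuous on `K` and holomorphic inside, and Mergelyan's theorem applies
(`PolyApprox.of_starConvex`).

Mergelyan's theorem is proved for star-shaped `K`. The function is smoothed and written by the
Cauchy-Pompeiu formula as an integral of Cauchy kernels. The kernels are replaced by functions
holomorphic off short radial slits outside `K`, with an error controlled by the modulus of
continuity. Only finitely many slits are needed, so the result is holomorphic near `K`. Runge's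
theorem finishes: dilations `F(tz)` are moved from `t = 0`, where they are constant, to `t = 1` by
Taylor expansions. -/

/-- `F` is a uniform limit on `K` of complex polynomials. -/
def PolyApprox (K : Set ℂ) (F : ℂ → ℂ) : Prop :=
  ∀ ε : ℝ, 0 < ε → ∃ p : Polynomial ℂ, ∀ z ∈ K, ‖F z - p.eval z‖ < ε

/-! ### Uniform limits of polynomials -/

namespace PolyApprox

variable {K : Set ℂ} {F G : ℂ → ℂ}

theorem polynomial (p : Polynomial ℂ) : PolyApprox K fun z => p.eval z :=
  fun _ hε => ⟨p, fun _ _ => by simpa using hε⟩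

theorem const (c : ℂ) : PolyApprox K fun _ => c := by
  simpa using polynomial (K := K) (Polynomial.C c)

theorem of_approx (h : ∀ ε : ℝ, 0 < ε → ∃ G, PolyApprox K G ∧ ∀ z ∈ K, ‖F z - G z‖ < ε) :
    PolyApprox K F := by
  intro ε hε
  obtain ⟨G, hG, hFG⟩ := h (ε / 2) (by positivity)
  obtain ⟨p, hp⟩ := hG (ε / 2) (by positivity)
  refine ⟨p, fun z hz => ?_⟩
  have := norm_sub_le_norm_sub_add_norm_sub (F z) (G z) (p.eval z)
  linarith [hFG z hz, hp z hz]

theorem congr (hG : PolyApprox K G) (h : ∀ z ∈ K, F z = G z) : PolyApprox K F :=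
  of_approx fun ε hε => ⟨G, hG, fun z hz => by simpa [h z hz] using hε⟩

theorem add (hF : PolyApprox K F) (hG : PolyApprox K G) : PolyApprox K fun z => F z + G z := by
  intro ε hε
  obtain ⟨p, hp⟩ := hF (ε / 2) (by positivity)
  obtain ⟨q, hq⟩ := hG (ε / 2) (by positivity)
  refine ⟨p + q, fun z hz => ?_⟩
  rw [Polynomial.eval_add, add_sub_add_comm]
  linarith [norm_add_le (F z - p.eval z) (G z - q.eval z), hp z hz, hq z hz]

theorem sum {ι : Type*} (s : Finset ι) {F : ι → ℂ → ℂ} (h : ∀ i ∈ s, PolyApprox K (F i)) :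
    PolyApprox K fun z => ∑ i ∈ s, F i z := by
  classical
  induction s using Finset.induction_on with
  | empty => simpa using const (K := K) 0
  | insert a s ha ih =>
    simp only [Finset.sum_insert ha]
    exact (h a (by simp)).add (ih fun i hi => h i (by simp [hi]))

theorem mul_polynomial (hK : IsCompact K) (hF : PolyApprox K F) (q : Polynomial ℂ) :
    PolyApprox K fun z => F z * q.eval z := by
  intro ε hε
  obtain ⟨C, hC⟩ := hK.exists_bound_of_continuousOn (f := fun z => q.eval z)
    q.continuous.continuousOn
  have hC' : 0 < |C| + 1 := by positivity
  obtain ⟨p, hp⟩ := hF (ε / (|C| + 1)) (by positivity)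
  refine ⟨p * q, fun z hz => ?_⟩
  rw [Polynomial.eval_mul, ← sub_mul, norm_mul]
  calc ‖F z - p.eval z‖ * ‖q.eval z‖ ≤ ‖F z - p.eval z‖ * (|C| + 1) := by
        gcongr; linarith [hC z hz, le_abs_self C]
    _ < ε / (|C| + 1) * (|C| + 1) := by gcongr; exact hp z hz
    _ = ε := by field_simp

end PolyApprox

/-! ### Runge's theorem for star-shaped compact sets -/

theorem DifferentiableOn.iteratedDeriv {F : ℂ → ℂ} {U : Set ℂ} (hF : DifferentiableOn ℂ F U)
    (hU : IsOpen U) (n : ℕ) : DifferentiableOn ℂ (iteratedDeriv n F) U := by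
  induction n with
  | zero => simpa using hF
  | succ n ih => rw [iteratedDeriv_succ]; exact ih.deriv hU

/-- One Taylor step of the proof of Runge's theorem for star-shaped compact sets. -/
theorem PolyApprox.comp_dilation_step {K U : Set ℂ} (hK : IsCompact K) (hU : IsOpen U)
    (hstar : ∀ z ∈ K, ∀ t : ℝ, 0 ≤ t → t ≤ 1 → (t : ℂ) * z ∈ K)
    {η R : ℝ} (hη : 0 < η) (hηU : Metric.cthickening η K ⊆ U) (hR : ∀ z ∈ K, ‖z‖ ≤ R)
    {t s : ℝ} (ht0 : 0 ≤ t) (ht1 : t ≤ 1) (hs : |s| * R ≤ η / 2)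
    (h : ∀ F : ℂ → ℂ, DifferentiableOn ℂ F U → PolyApprox K fun z => F (t * z))
    (F : ℂ → ℂ) (hF : DifferentiableOn ℂ F U) : PolyApprox K fun z => F ((t + s : ℝ) * z) := by
  obtain ⟨M, hM⟩ := (hK.cthickening (r := η)).exists_bound_of_continuousOn
    (hF.continuousOn.mono hηU)
  have hball : ∀ w ∈ K, Metric.closedBall w η ⊆ Metric.cthickening η K := fun w hw =>
    Metric.closedBall_subset_cthickening hw η
  -- Taylor terms of `F` at `t z`. The increment is `s z`, so each term is a polynomial times a
  -- derivative of `F` at `t z`, to which `h` applies.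
  set f : ℕ → ℂ → ℂ := fun n z =>
    (n.factorial : ℂ)⁻¹ • ((t + s : ℝ) * z - t * z) ^ n • iteratedDeriv n F (t * z) with hf
  have hsz : ∀ z ∈ K, ‖((t + s : ℝ) * z - t * z : ℂ)‖ ≤ η / 2 := by
    intro z hz
    have : ((t + s : ℝ) * z - t * z : ℂ) = s * z := by push_cast; ring
    rw [this, norm_mul, Complex.norm_real, Real.norm_eq_abs]
    exact (mul_le_mul_of_nonneg_left (hR z hz) (abs_nonneg s)).trans hs
  have hsum : ∀ z ∈ K, HasSum (fun n => f n z) (F ((t + s : ℝ) * z)) := by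
    intro z hz
    have hw := hstar z hz t ht0 ht1
    refine Complex.hasSum_taylorSeries_on_ball (c := t * z) (r := η) ?_ ?_
    · exact hF.mono ((Metric.ball_subset_closedBall.trans (hball _ hw)).trans hηU)
    · rw [Metric.mem_ball, dist_eq_norm]
      exact lt_of_le_of_lt (hsz z hz) (by linarith)
  -- Cauchy's estimate on radius `η` against an increment of at most `η / 2`: the series converges
  -- uniformly on `K`.
  have hbd : ∀ n, ∀ z ∈ K, ‖f n z‖ ≤ M * (1 / 2) ^ n := by
    intro n z hz
    have hw := hstar z hz t ht0 ht1
    have h1 : ‖iteratedDeriv n F (t * z)‖ ≤ n.factorial * M / η ^ n := by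
      refine Complex.norm_iteratedDeriv_le_of_forall_mem_sphere_norm_le n hη ?_ ?_
      · refine (hF.mono ?_).diffContOnCl
        exact ((Metric.closure_ball_subset_closedBall).trans (hball _ hw)).trans hηU
      · exact fun y hy => hM y (hball _ hw (Metric.sphere_subset_closedBall hy))
    have hM0 : 0 ≤ M := (norm_nonneg _).trans (hM _ (hball _ hw (Metric.mem_closedBall_self hη.le)))
    rw [hf]
    simp only [norm_smul, norm_inv, norm_pow, Complex.norm_natCast]
    calc (n.factorial : ℝ)⁻¹ * (‖((t + s : ℝ) * z - t * z : ℂ)‖ ^ n * ‖iteratedDeriv n F (t * z)‖)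
        ≤ (n.factorial : ℝ)⁻¹ * ((η / 2) ^ n * (n.factorial * M / η ^ n)) := by
          gcongr; exact hsz z hz
      _ = M * (1 / 2) ^ n := by
          have : (n.factorial : ℝ) ≠ 0 := by positivity
          rw [div_pow, div_pow]; field_simp; simp
  have hunif := tendstoUniformlyOn_tsum_nat (s := K)
    ((summable_geometric_two).mul_left M) hbd
  refine PolyApprox.of_approx fun ε hε => ?_
  obtain ⟨N, hN⟩ := (Metric.tendstoUniformlyOn_iff.1 hunif ε hε).exists
  refine ⟨fun z => ∑ n ∈ Finset.range N, f n z, PolyApprox.sum _ fun n _ => ?_, fun z hz => ?_⟩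
  · have h1 := (h (iteratedDeriv n F) (hF.iteratedDeriv hU n)).mul_polynomial hK
      (Polynomial.C ((n.factorial : ℂ)⁻¹) * (Polynomial.C (s : ℂ) * Polynomial.X) ^ n)
    refine h1.congr fun z _ => ?_
    simp only [hf, smul_eq_mul, Polynomial.eval_mul, Polynomial.eval_pow, Polynomial.eval_C,
      Polynomial.eval_X]
    push_cast
    ring
  · have := hN z hz
    rwa [(hsum z hz).tsum_eq, dist_eq_norm] at this

/-- Runge's theorem for compact sets that are star-shaped with respect to the origin. -/
theorem PolyApprox.of_differentiableOn {K U : Set ℂ} (hK : IsCompact K) (hU : IsOpen U)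
    (hKU : K ⊆ U) (hstar : ∀ z ∈ K, ∀ t : ℝ, 0 ≤ t → t ≤ 1 → (t : ℂ) * z ∈ K)
    {F : ℂ → ℂ} (hF : DifferentiableOn ℂ F U) : PolyApprox K F := by
  obtain ⟨η, hη, hηU⟩ := hK.exists_cthickening_subset_open hU hKU
  obtain ⟨R, hR0, hR⟩ := hK.isBounded.exists_pos_norm_le
  obtain ⟨N, hN⟩ := exists_nat_gt (2 * R / η)
  have hN0 : 0 < (N : ℝ) := lt_of_le_of_lt (by positivity) hN
  -- The induction covers all `F` at once because the Taylor step uses the derivatives of `F`. The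
  -- choice of `N` makes one step `1 / N` move points of `K` by at most `η / 2`.
  have key : ∀ k : ℕ, k ≤ N → ∀ F : ℂ → ℂ, DifferentiableOn ℂ F U →
      PolyApprox K fun z => F ((k / N : ℝ) * z) := by
    intro k
    induction k with
    | zero => intro _ F _; simpa using PolyApprox.const (K := K) (F 0)
    | succ k ih =>
      intro hk F hF
      have h1 : ((k + 1 : ℕ) / N : ℝ) = k / N + 1 / N := by push_cast; ring
      rw [h1]
      refine PolyApprox.comp_dilation_step hK hU hstar hη hηU hR (by positivity) ?_ ?_
        (ih (by omega)) F hF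
      · rw [div_le_one hN0]; exact_mod_cast (by omega : k ≤ N)
      · rw [abs_of_nonneg (by positivity)]
        rw [div_lt_iff₀ hη] at hN
        rw [div_mul_eq_mul_div, div_le_iff₀ hN0]
        linarith
  have := key N le_rfl F hF
  simpa [div_self hN0.ne'] using this

/-! ### Kernels holomorphic off a segment -/

/-- The inverse of the Joukowski map `h ↦ (h + h⁻¹) / 2` that maps the complement of `[-1, 1]`
into the unit disc. -/
noncomputable def slitInv (s : ℂ) : ℂ := s - s * (1 - 1 / s ^ 2) ^ ((2 : ℕ) : ℂ)⁻¹

/-- The real segment `[-1, 1]` in the complex plane. -/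
def unitSlit : Set ℂ := (fun t : ℝ => (t : ℂ)) '' Set.Icc (-1) 1

theorem isClosed_unitSlit : IsClosed unitSlit :=
  (isCompact_Icc.image Complex.continuous_ofReal).isClosed

/-- If `1 - 1 / s²` is a nonpositive real, then `1 / s² = r ≥ 1`, so `s = ±√(1 / r)` lies on the
slit. Hence the principal root in `slitInv` is holomorphic off the slit. -/
theorem one_sub_mem_slitPlane {s : ℂ} (hs : s ∉ unitSlit) : 1 - 1 / s ^ 2 ∈ Complex.slitPlane := by
  rw [Complex.mem_slitPlane_iff_not_le_zero]
  intro h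
  apply hs
  obtain ⟨hre, him⟩ := Complex.le_def.1 h
  set r : ℝ := (1 / s ^ 2).re with hr
  have h1 : 1 / s ^ 2 = (r : ℂ) := by
    apply Complex.ext
    · rw [hr, Complex.ofReal_re]
    · simpa using him
  have hr1 : 1 ≤ r := by
    have : (1 - 1 / s ^ 2 : ℂ).re = 1 - r := by rw [h1]; simp
    rw [this] at hre; simpa using hre
  have h2 : s ^ 2 = ((√(1 / r) : ℝ) : ℂ) ^ 2 := by
    rw [← Complex.ofReal_pow, Real.sq_sqrt (by positivity)]
    push_cast
    rw [← h1, one_div_one_div]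
  have h3 : √(1 / r) ≤ 1 := by
    rw [Real.sqrt_le_one, div_le_one (by linarith)]; exact hr1
  have h4 := Real.sqrt_nonneg (1 / r)
  rcases sq_eq_sq_iff_eq_or_eq_neg.1 h2 with h | h
  · exact ⟨√(1 / r), ⟨by linarith, h3⟩, h.symm⟩
  · exact ⟨-√(1 / r), ⟨by linarith, by linarith⟩, by simp [h]⟩

theorem ne_zero_of_notMem_unitSlit {s : ℂ} (hs : s ∉ unitSlit) : s ≠ 0 := by
  rintro rfl
  exact hs ⟨0, by simp, by simp⟩

theorem slitInv_eq {s : ℂ} (hs : s ∉ unitSlit) : slitInv s ^ 2 + 1 = 2 * s * slitInv s := by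
  have hs0 := ne_zero_of_notMem_unitSlit hs
  have hw := Complex.cpow_nat_inv_pow (1 - 1 / s ^ 2) two_ne_zero
  rw [slitInv]
  set w := (1 - 1 / s ^ 2) ^ ((2 : ℕ) : ℂ)⁻¹
  have : s ^ 2 * w ^ 2 = s ^ 2 - 1 := by rw [hw]; field_simp
  linear_combination this

/-- The two roots `s(1 - w)` and `s(1 + w)` of the Joukowski equation have product `1`. The
principal root `w` has nonnegative real part, so `s(1 - w)` is the smaller one. -/
theorem norm_slitInv_le_one {s : ℂ} (hs : s ∉ unitSlit) : ‖slitInv s‖ ≤ 1 := by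
  have hs0 := ne_zero_of_notMem_unitSlit hs
  have hp := one_sub_mem_slitPlane hs
  have hw := Complex.cpow_nat_inv_pow (1 - 1 / s ^ 2) two_ne_zero
  have hre : 0 ≤ ((1 - 1 / s ^ 2) ^ ((2 : ℕ) : ℂ)⁻¹).re := by
    rw [Complex.cpow_def_of_ne_zero (Complex.slitPlane_ne_zero hp), Complex.exp_re]
    refine mul_nonneg (Real.exp_pos _).le (Real.cos_nonneg_of_mem_Icc ?_)
    have h1 := Complex.neg_pi_lt_arg (1 - 1 / s ^ 2)
    have h2 := Complex.arg_le_pi (1 - 1 / s ^ 2)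
    have : (Complex.log (1 - 1 / s ^ 2) * ((2 : ℕ) : ℂ)⁻¹).im = (1 - 1 / s ^ 2).arg / 2 := by
      rw [show (((2 : ℕ) : ℂ)⁻¹) = ((2⁻¹ : ℝ) : ℂ) by push_cast; rfl, Complex.im_mul_ofReal,
        Complex.log_im]; ring
    rw [this]
    constructor <;> linarith
  rw [slitInv]
  set w := (1 - 1 / s ^ 2) ^ ((2 : ℕ) : ℂ)⁻¹
  have h1 : ‖1 - w‖ ≤ ‖1 + w‖ := by
    rw [← sq_le_sq₀ (norm_nonneg _) (norm_nonneg _), ← Complex.normSq_eq_norm_sq,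
      ← Complex.normSq_eq_norm_sq, Complex.normSq_apply, Complex.normSq_apply]
    simp
    nlinarith
  have h2 : ‖s * (1 - w)‖ * ‖s * (1 + w)‖ = 1 := by
    rw [← norm_mul]
    have : s * (1 - w) * (s * (1 + w)) = 1 := by
      have : s ^ 2 * w ^ 2 = s ^ 2 - 1 := by rw [hw]; field_simp
      linear_combination -this
    rw [this, norm_one]
  have h3 : ‖s * (1 - w)‖ ≤ ‖s * (1 + w)‖ := by
    rw [norm_mul, norm_mul]; gcongr
  have : s - s * w = s * (1 - w) := by ring
  rw [this]
  nlinarith [norm_nonneg (s * (1 - w))]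

theorem differentiableAt_slitInv {s : ℂ} (hs : s ∉ unitSlit) : DifferentiableAt ℂ slitInv s := by
  have hs0 := ne_zero_of_notMem_unitSlit hs
  have hp := one_sub_mem_slitPlane hs
  unfold slitInv
  refine differentiableAt_id.sub (differentiableAt_id.mul (DifferentiableAt.cpow ?_ ?_ hp))
  · refine (differentiableAt_const _).sub ((differentiableAt_const _).div ?_ (by simpa using hs0))
    fun_prop
  · fun_prop

theorem norm_slitInv_mul_le {s : ℂ} (hs : s ∉ unitSlit) : ‖slitInv s‖ * ‖s‖ ≤ 1 := by
  have h := congrArg norm (slitInv_eq hs)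
  rw [norm_mul, norm_mul] at h
  have h1 : ‖slitInv s ^ 2 + 1‖ ≤ 1 + 1 := by
    refine (norm_add_le _ _).trans ?_
    rw [norm_pow, norm_one]
    gcongr
    exact pow_le_one₀ (norm_nonneg _) (norm_slitInv_le_one hs)
  simp at h
  linarith

/-- A function holomorphic off the segment `[m - d, m + d]`, bounded by `2 / ‖d‖` and close to
`1 / (z - m)` at infinity. -/
noncomputable def slitKernel (m d z : ℂ) : ℂ := 2 / d * slitInv ((z - m) / d)

section

variable {m d z : ℂ}

theorem differentiableAt_slitKernel (hz : (z - m) / d ∉ unitSlit) :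
    DifferentiableAt ℂ (slitKernel m d) z := by
  unfold slitKernel
  refine (differentiableAt_const _).mul ?_
  exact DifferentiableAt.comp (g := slitInv) z (differentiableAt_slitInv hz) (by fun_prop)

theorem norm_slitKernel_le (hz : (z - m) / d ∉ unitSlit) : ‖slitKernel m d z‖ ≤ 2 / ‖d‖ := by
  rw [slitKernel, norm_mul, norm_div, Complex.norm_ofNat]
  exact mul_le_of_le_one_right (by positivity) (norm_slitInv_le_one hz)

theorem norm_slitKernel_mul_le (hd : d ≠ 0) (hz : (z - m) / d ∉ unitSlit) :
    ‖slitKernel m d z‖ * ‖z - m‖ ≤ 2 := by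
  have h := norm_slitInv_mul_le hz
  have hd' : ‖d‖ ≠ 0 := norm_ne_zero_iff.2 hd
  rw [norm_div] at h
  rw [slitKernel, norm_mul, norm_div, Complex.norm_ofNat]
  calc 2 / ‖d‖ * ‖slitInv ((z - m) / d)‖ * ‖z - m‖
      = 2 * (‖slitInv ((z - m) / d)‖ * (‖z - m‖ / ‖d‖)) := by field_simp
    _ ≤ 2 := by linarith

/-- With `s = (z - m) / d` and `h = slitInv s`, the equation `2sh = h² + 1` turns the left side into
`|d|² |hs|²`. The expansion at infinity therefore has no term in `(z - m)⁻²`, which makes the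
correction in `mergelyanKernel` explicit. -/
theorem norm_slitKernel_sub_mul_le (hd : d ≠ 0) (hz : (z - m) / d ∉ unitSlit) :
    ‖slitKernel m d z - 1 / (z - m)‖ * ‖z - m‖ ^ 3 ≤ ‖d‖ ^ 2 := by
  have hd' : ‖d‖ ≠ 0 := norm_ne_zero_iff.2 hd
  have hs0 := ne_zero_of_notMem_unitSlit hz
  have hv : z - m ≠ 0 := fun h => hs0 (by simp [h])
  have h := norm_slitInv_mul_le hz
  have he := slitInv_eq hz
  set h0 := slitInv ((z - m) / d)
  have h1 : (slitKernel m d z - 1 / (z - m)) * (z - m) ^ 3 = d ^ 2 * (h0 * ((z - m) / d)) ^ 2 := by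
    rw [slitKernel]
    change (2 / d * h0 - 1 / (z - m)) * (z - m) ^ 3 = _
    field_simp
    field_simp at he
    linear_combination -he
  rw [← norm_pow, ← norm_mul, h1, norm_mul, norm_pow, norm_pow, norm_mul]
  refine mul_le_of_le_one_right (by positivity) (pow_le_one₀ (by positivity) h)

/-- The kernel of Mergelyan's theorem, which replaces the Cauchy kernel `1 / (z - ζ)`. -/
noncomputable def mergelyanKernel (m d ζ z : ℂ) : ℂ :=
  slitKernel m d z + (ζ - m) * slitKernel m d z ^ 2

/-- The integrable majorant of the difference of the Cauchy kernel and `mergelyanKernel`. -/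
noncomputable def kernelMajorant (δ r : ℝ) : ℝ := δ ^ 2 / (r * (δ ^ 2 + r ^ 2))

/-- With `g = slitKernel m d z`, the kernel `g + (ζ - m) g²` agrees with `1 / (z - ζ)` at infinity
up to order `(z - m)⁻²`. The error thus decays like `δ² / r³`, which is integrable at infinity; near
`ζ` only the singularity `1 / r` remains. -/
theorem norm_mergelyanKernel_sub_le {ζ : ℂ} (hd : d ≠ 0) (hz : (z - m) / d ∉ unitSlit)
    (hζ : ‖ζ - m‖ ≤ 5 * ‖d‖) (hne : z ≠ ζ) :
    ‖mergelyanKernel m d ζ z - 1 / (z - ζ)‖ ≤ 30000 * kernelMajorant ‖d‖ ‖z - ζ‖ := by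
  have hδ : 0 < ‖d‖ := norm_pos_iff.2 hd
  have hu0 : z - ζ ≠ 0 := sub_ne_zero.2 hne
  have hu : 0 < ‖z - ζ‖ := norm_pos_iff.2 hu0
  have hv0 : z - m ≠ 0 := fun h => ne_zero_of_notMem_unitSlit hz (by simp [h])
  have hv : 0 < ‖z - m‖ := norm_pos_iff.2 hv0
  have hg := norm_slitKernel_le hz
  have hgv := norm_slitKernel_mul_le hd hz
  have hgs := norm_slitKernel_sub_mul_le hd hz
  have huv : ‖z - ζ‖ ≤ ‖z - m‖ + ‖ζ - m‖ := by
    have := norm_sub_le (z - m) (ζ - m); simpa using this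
  rw [mergelyanKernel, kernelMajorant]
  set g := slitKernel m d z
  set δ := ‖d‖
  set r := ‖z - ζ‖
  set R := ‖z - m‖
  rw [← mul_div_assoc, le_div_iff₀ (by positivity)]
  -- Near `ζ` the two kernels are bounded separately; this case fixes the constant, as `221 · 101 <
  -- 30000`. Far away, `r ≤ 2R` allows expansions in `1 / R`.
  by_cases hcase : r ≤ 10 * δ
  · have h1 : ‖g + (ζ - m) * g ^ 2 - 1 / (z - ζ)‖ ≤ 22 / δ + 1 / r := by
      refine (norm_sub_le _ _).trans ?_
      rw [norm_div, norm_one]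
      gcongr
      refine (norm_add_le _ _).trans ?_
      rw [norm_mul, norm_pow]
      calc ‖g‖ + ‖ζ - m‖ * ‖g‖ ^ 2 ≤ 2 / δ + 5 * δ * (2 / δ) ^ 2 := by gcongr
        _ = 22 / δ := by field_simp; norm_num
    calc ‖g + (ζ - m) * g ^ 2 - 1 / (z - ζ)‖ * (r * (δ ^ 2 + r ^ 2))
        ≤ (22 / δ + 1 / r) * (r * (δ ^ 2 + r ^ 2)) := by gcongr
      _ = (22 * (r / δ) + 1) * (δ ^ 2 + r ^ 2) := by field_simp
      _ ≤ (22 * 10 + 1) * (δ ^ 2 + (10 * δ) ^ 2) := by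
          gcongr; rwa [div_le_iff₀ hδ]
      _ ≤ 30000 * δ ^ 2 := by nlinarith [sq_nonneg δ]
  · push Not at hcase
    have hRr : r ≤ 2 * R := by linarith
    -- Subtracts the expansion of `1 / (z - ζ)` about `m` to second order, with its exact remainder.
    have h1 : g + (ζ - m) * g ^ 2 - 1 / (z - ζ) = (g - 1 / (z - m))
        + (ζ - m) * ((g - 1 / (z - m)) * (g + 1 / (z - m)))
        - (ζ - m) ^ 2 / ((z - m) ^ 2 * (z - ζ)) := by
      field_simp
      ring
    have h2 : ‖g - 1 / (z - m)‖ ≤ δ ^ 2 / R ^ 3 := by rwa [le_div_iff₀ (by positivity)]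
    have h3 : ‖g + 1 / (z - m)‖ ≤ 3 / R := by
      refine (norm_add_le _ _).trans ?_
      rw [norm_div, norm_one]
      have : ‖g‖ ≤ 2 / R := by rwa [le_div_iff₀ hv]
      calc ‖g‖ + 1 / R ≤ 2 / R + 1 / R := by gcongr
        _ = 3 / R := by ring
    have h4 : ‖g + (ζ - m) * g ^ 2 - 1 / (z - ζ)‖ ≤ δ ^ 2 / R ^ 3
        + 5 * δ * (δ ^ 2 / R ^ 3 * (3 / R)) + (5 * δ) ^ 2 / (R ^ 2 * r) := by
      rw [h1]
      refine (norm_sub_le _ _).trans ?_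
      refine add_le_add ((norm_add_le _ _).trans ?_) ?_
      · rw [norm_mul, norm_mul]; gcongr
      · rw [norm_div, norm_mul, norm_pow, norm_pow]; gcongr
    have h5 : δ ^ 2 / R ^ 3 + 5 * δ * (δ ^ 2 / R ^ 3 * (3 / R)) + (5 * δ) ^ 2 / (R ^ 2 * r)
        ≤ 200 * δ ^ 2 / r ^ 3 := by
      have hR2 : r / 2 ≤ R := by linarith
      calc δ ^ 2 / R ^ 3 + 5 * δ * (δ ^ 2 / R ^ 3 * (3 / R)) + (5 * δ) ^ 2 / (R ^ 2 * r)
          ≤ δ ^ 2 / (r / 2) ^ 3 + 5 * δ * (δ ^ 2 / (r / 2) ^ 3 * (3 / (r / 2)))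
            + (5 * δ) ^ 2 / ((r / 2) ^ 2 * r) := by gcongr
        _ = (108 + 240 * (δ / r)) * δ ^ 2 / r ^ 3 := by field_simp; ring
        _ ≤ 200 * δ ^ 2 / r ^ 3 := by
          gcongr
          have : δ / r ≤ 1 / 10 := by rw [div_le_iff₀ hu]; linarith
          linarith
    calc ‖g + (ζ - m) * g ^ 2 - 1 / (z - ζ)‖ * (r * (δ ^ 2 + r ^ 2))
        ≤ 200 * δ ^ 2 / r ^ 3 * (r * (2 * r ^ 2)) := by
          gcongr
          · exact h4.trans h5
          · nlinarith
      _ = 400 * δ ^ 2 := by field_simp; ring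
      _ ≤ 30000 * δ ^ 2 := by nlinarith [sq_nonneg δ]

end

/-! ### Polar coordinates and the Cauchy-Pompeiu formula -/

section PolarIntegrals

open MeasureTheory Set Real

/-- The point of the unit circle with argument `θ`. -/
noncomputable def unitVec (θ : ℝ) : ℂ := (Real.cos θ : ℂ) + (Real.sin θ : ℂ) * Complex.I

theorem unitVec_eq_exp (θ : ℝ) : unitVec θ = Complex.exp (θ * Complex.I) := by
  rw [unitVec, Complex.exp_mul_I]; simp

theorem norm_unitVec (θ : ℝ) : ‖unitVec θ‖ = 1 := by
  rw [unitVec_eq_exp, Complex.norm_exp_ofReal_mul_I]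

theorem continuous_unitVec : Continuous unitVec := by
  unfold unitVec; fun_prop

theorem hasDerivAt_unitVec (θ : ℝ) : HasDerivAt unitVec (Complex.I * unitVec θ) θ := by
  have h1 := (Real.hasDerivAt_cos θ).ofReal_comp
  have h2 := ((Real.hasDerivAt_sin θ).ofReal_comp).mul_const Complex.I
  refine (h1.add h2).congr_deriv ?_
  rw [unitVec]
  push_cast
  linear_combination -(Complex.sin θ) * Complex.I_mul_I

theorem integrableOn_polarCoord_target {G : ℝ × ℝ → ℂ} (hG : Continuous G) {R : ℝ}
    (hR : ∀ p : ℝ × ℝ, R < p.1 → G p = 0) :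
    IntegrableOn G (Ioi 0 ×ˢ Ioo (-π) π) (volume.prod volume) := by
  have h : IntegrableOn G (Icc 0 R ×ˢ Icc (-π) π) (volume.prod volume) :=
    hG.continuousOn.integrableOn_compact (isCompact_Icc.prod isCompact_Icc)
  refine h.of_forall_sdiff_eq_zero (measurableSet_Ioi.prod measurableSet_Ioo) ?_
  rintro ⟨r, θ⟩ ⟨⟨hr, hθ⟩, hn⟩
  refine hR _ ?_
  by_contra hle
  exact hn ⟨⟨le_of_lt hr, not_lt.1 hle⟩, Ioo_subset_Icc_self hθ⟩

/-- The Jacobian `r` is absorbed into `G`, which can then be continuous up to `r = 0` even when `g`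
has a singularity like `1 / z`. -/
theorem integral_eq_polar {g : ℂ → ℂ} {G : ℝ × ℝ → ℂ} (hG : Continuous G) {R : ℝ}
    (hR : ∀ p : ℝ × ℝ, R < p.1 → G p = 0)
    (hgG : ∀ r θ : ℝ, 0 < r → (r : ℂ) * g (r * unitVec θ) = G (r, θ)) :
    ∫ z, g z = ∫ r in Ioi 0, ∫ θ in Ioo (-π) π, G (r, θ) := by
  rw [← Complex.integral_comp_polarCoord_symm, ← setIntegral_prod _
    (integrableOn_polarCoord_target hG hR), ← Measure.volume_eq_prod]
  refine setIntegral_congr_fun (measurableSet_Ioi.prod measurableSet_Ioo) ?_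
  rintro ⟨r, θ⟩ ⟨hr, -⟩
  simp only [Complex.polarCoord_symm_apply]
  rw [← hgG r θ hr, Complex.real_smul]
  rfl

/-- The operator `∂/∂x + i ∂/∂y`. -/
noncomputable def dbar (Φ : ℂ → ℂ) (z : ℂ) : ℂ :=
  fderiv ℝ Φ z 1 + Complex.I * fderiv ℝ Φ z Complex.I

/-- The Cauchy-Pompeiu formula for compactly supported functions, at the origin. -/
theorem integral_dbar_div {Φ : ℂ → ℂ} (hΦ : ContDiff ℝ 1 Φ) (hc : HasCompactSupport Φ) :
    ∫ z, dbar Φ z / z = -(2 * π) * Φ 0 := by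
  obtain ⟨R, hR⟩ := hc.isCompact.isBounded.subset_closedBall 0
  have hDcont : Continuous (fderiv ℝ Φ) := hΦ.continuous_fderiv one_ne_zero
  have hdiff : ∀ z, HasFDerivAt Φ (fderiv ℝ Φ z) z := fun z =>
    (hΦ.differentiable one_ne_zero z).hasFDerivAt
  have hzero : ∀ z, R < ‖z‖ → fderiv ℝ Φ z = 0 := by
    intro z hz
    by_contra h
    have : z ∈ tsupport Φ := support_fderiv_subset ℝ h
    have := hR this
    rw [mem_closedBall_zero_iff] at this
    linarith
  -- `A` is the radial derivative and `r B` the angular one. Since `∂x + i∂y = e^{iθ}(∂r + (i /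
  -- r)∂θ)`, the integrand times the Jacobian is `A + iB`.
  set A : ℝ × ℝ → ℂ := fun p => fderiv ℝ Φ (p.1 * unitVec p.2) (unitVec p.2) with hA
  set B : ℝ × ℝ → ℂ := fun p => fderiv ℝ Φ (p.1 * unitVec p.2) (Complex.I * unitVec p.2) with hB
  have hpt : Continuous fun p : ℝ × ℝ => (p.1 * unitVec p.2 : ℂ) :=
    (Complex.continuous_ofReal.comp continuous_fst).mul (continuous_unitVec.comp continuous_snd)
  have hAc : Continuous A :=
    (hDcont.comp hpt).clm_apply (continuous_unitVec.comp continuous_snd)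
  have hBc : Continuous B :=
    (hDcont.comp hpt).clm_apply (continuous_const.mul (continuous_unitVec.comp continuous_snd))
  have hnorm : ∀ p : ℝ × ℝ, |R| < p.1 → fderiv ℝ Φ (p.1 * unitVec p.2) = 0 := by
    intro p hp
    refine hzero _ ?_
    rw [norm_mul, norm_unitVec, Complex.norm_real, mul_one]
    exact (le_abs_self R).trans_lt (hp.trans_le (le_abs_self _))
  have hA0 : ∀ p : ℝ × ℝ, |R| < p.1 → A p = 0 := fun p hp => by simp [hA, hnorm p hp]
  have hB0 : ∀ p : ℝ × ℝ, |R| < p.1 → B p = 0 := fun p hp => by simp [hB, hnorm p hp]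
  have hAi := integrableOn_polarCoord_target hAc hA0
  have hBi := integrableOn_polarCoord_target hBc hB0
  rw [integral_eq_polar (G := fun p => A p + Complex.I * B p) (R := |R|) (by fun_prop)
    (fun p hp => by simp [hA0 p hp, hB0 p hp])]
  · have hIB : IntegrableOn (fun p => Complex.I * B p) (Ioi 0 ×ˢ Ioo (-π) π)
        (volume.prod volume) := Integrable.const_mul hBi _
    rw [← setIntegral_prod (f := fun p => A p + Complex.I * B p) (hAi.add hIB),
      integral_add hAi hIB, integral_const_mul]
    -- On each circle `r B` is the derivative of a `2π`-periodic function of the angle.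
    have h1 : ∫ p in Ioi 0 ×ˢ Ioo (-π) π, B p ∂(volume.prod volume) = 0 := by
      rw [setIntegral_prod _ hBi]
      refine setIntegral_eq_zero_of_forall_eq_zero fun r hr => ?_
      have hr0 : (r : ℂ) ≠ 0 := by exact_mod_cast (ne_of_gt hr)
      have h2 : ∫ θ in (-π)..π, (r : ℂ) * B (r, θ) = 0 := by
        rw [intervalIntegral.integral_eq_sub_of_hasDerivAt (f := fun θ => Φ (r * unitVec θ))]
        · simp [unitVec]
        · intro θ _
          have h3 := (hdiff (r * unitVec θ)).comp_hasDerivAt θ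
            ((hasDerivAt_unitVec θ).const_mul (r : ℂ))
          refine h3.congr_deriv ?_
          have h4 := (fderiv ℝ Φ (r * unitVec θ)).map_smul r (Complex.I * unitVec θ)
          rwa [Complex.real_smul, Complex.real_smul] at h4
        · refine Continuous.intervalIntegrable ?_ _ _
          exact continuous_const.mul (hBc.comp (by fun_prop))
      rw [intervalIntegral.integral_const_mul] at h2
      have h4 := (mul_eq_zero.1 h2).resolve_left hr0
      rwa [intervalIntegral.integral_of_le (by linarith [pi_pos]), integral_Ioc_eq_integral_Ioo]
        at h4
    -- After the order of integration is exchanged, each radial integral telescopes to `-Φ 0`.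
    have h2 : ∫ p in Ioi 0 ×ˢ Ioo (-π) π, A p ∂(volume.prod volume) = -(2 * π) * Φ 0 := by
      rw [setIntegral_prod _ hAi, integral_integral_swap (f := fun r θ => A (r, θ))
        (by rw [Measure.prod_restrict]; exact hAi)]
      have h3 : ∀ θ : ℝ, ∫ r in Ioi 0, A (r, θ) = -Φ 0 := by
        intro θ
        have hd : ∀ r : ℝ, HasDerivAt (fun r : ℝ => Φ (r * unitVec θ)) (A (r, θ)) r := by
          intro r
          have h3 := (hdiff (r * unitVec θ)).comp_hasDerivAt r
            ((Complex.ofRealCLM.hasDerivAt (x := r)).mul_const (unitVec θ))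
          refine h3.congr_deriv ?_
          simp [hA]
        have h4 := HasCompactSupport.integral_Ioi_deriv_eq (f := fun r : ℝ => Φ (r * unitVec θ))
          (hΦ.comp (Complex.ofRealCLM.contDiff.mul contDiff_const)) (HasCompactSupport.intro (isCompact_Icc (a := -|R|) (b := |R|))
          (fun r hr => ?_)) 0
        · simpa [(hd _).deriv] using h4
        · by_contra h
          apply hr
          have := hR (subset_tsupport _ h)
          rw [mem_closedBall_zero_iff, norm_mul, norm_unitVec, Complex.norm_real, mul_one] at this
          exact abs_le.1 (this.trans (le_abs_self R))
      simp only [h3, integral_const, MeasureTheory.measureReal_restrict_apply_univ,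
        Real.volume_real_Ioo_of_le (by linarith [pi_pos] : -π ≤ π), Complex.real_smul]
      push_cast
      ring
    rw [h1, h2]; simp
  · intro r θ hr
    have hr0 : (r : ℂ) ≠ 0 := by exact_mod_cast (ne_of_gt hr)
    have hu : unitVec θ ≠ 0 := fun h => by simpa [h] using norm_unitVec θ
    have e1 : Complex.I * unitVec θ = ((-Real.sin θ : ℝ) : ℂ) + (Real.cos θ : ℝ) * Complex.I := by
      rw [unitVec]; push_cast; linear_combination (Complex.sin θ) * Complex.I_mul_I
    have e2 : (unitVec θ) * ((Real.cos θ : ℂ) - (Real.sin θ : ℂ) * Complex.I) = 1 := by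
      rw [unitVec]
      have := Complex.cos_sq_add_sin_sq θ
      push_cast
      linear_combination this - (Complex.sin θ) ^ 2 * Complex.I_mul_I
    simp only [hA, hB, dbar]
    generalize fderiv ℝ Φ (r * unitVec θ) = L
    have e3 : ∀ a b : ℝ, L (a + b * Complex.I) = a * L 1 + b * L Complex.I := by
      intro a b
      have : (a + b * Complex.I : ℂ) = a • (1 : ℂ) + b • Complex.I := by simp
      rw [this, map_add, map_smul, map_smul, Complex.real_smul, Complex.real_smul]
    have e4 : L (unitVec θ) = Real.cos θ * L 1 + Real.sin θ * L Complex.I := e3 _ _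
    rw [e1, e3, e4, ← mul_div_assoc, mul_div_mul_left _ _ hr0, div_eq_iff hu]
    push_cast
    push_cast at e2
    linear_combination -(L 1 + Complex.I * L Complex.I) * e2
      - unitVec θ * Complex.sin θ * L Complex.I * Complex.I_mul_I

end PolarIntegrals

/-! ### Smoothing by radial averages -/

section Mollification

open MeasureTheory Set Real Metric Convolution

/-- A radial smooth bump supported in the closed unit disc. -/
noncomputable def radialBump (z : ℂ) : ℝ := Real.smoothTransition (1 - ‖z‖ ^ 2)

theorem contDiff_radialBump : ContDiff ℝ 1 radialBump :=
  Real.smoothTransition.contDiff.comp (contDiff_const.sub (contDiff_norm_sq ℝ))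

theorem support_radialBump : Function.support radialBump ⊆ ball 0 1 := by
  intro z hz
  rw [mem_ball_zero_iff]
  by_contra h
  push Not at h
  exact hz (Real.smoothTransition.zero_of_nonpos (by nlinarith))

theorem hasCompactSupport_radialBump : HasCompactSupport radialBump :=
  HasCompactSupport.of_support_subset_isCompact (isCompact_closedBall 0 1)
    (support_radialBump.trans ball_subset_closedBall)

theorem integral_radialBump_pos : 0 < ∫ z, radialBump z := by
  refine Continuous.integral_pos_of_hasCompactSupport_nonneg_nonzero
    contDiff_radialBump.continuous hasCompactSupport_radialBump
    (fun z => Real.smoothTransition.nonneg _) (x := 0) ?_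
  simp [radialBump]

/-- Rescaling one radial bump keeps its mass and multiplies the `L¹` norm of its gradient by `1 /
δ`, so `C` does not depend on `δ`. -/
theorem exists_radial_mollifier : ∃ C : ℝ, 0 < C ∧ ∀ δ : ℝ, 0 < δ → ∃ A : ℂ → ℝ,
    ContDiff ℝ 1 A ∧ HasCompactSupport A ∧ Function.support A ⊆ ball 0 δ ∧ (∀ z, 0 ≤ A z) ∧
    ∫ z, A z = 1 ∧ (∀ z w, ‖z‖ = ‖w‖ → A z = A w) ∧ ∫ z, ‖fderiv ℝ A z‖ ≤ C / δ := by
  set N := ∫ z, radialBump z with hN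
  have hN0 : 0 < N := integral_radialBump_pos
  set D := ∫ z, ‖fderiv ℝ radialBump z‖ with hD
  have hD0 : 0 ≤ D := integral_nonneg fun _ => norm_nonneg _
  refine ⟨N⁻¹ * D + 1, by positivity, fun δ hδ => ?_⟩
  set A : ℂ → ℝ := fun z => (N⁻¹ * δ⁻¹ ^ 2) * radialBump (δ⁻¹ • z) with hA
  have hcd : ContDiff ℝ 1 fun z : ℂ => radialBump (δ⁻¹ • z) :=
    contDiff_radialBump.comp (contDiff_const_smul _)
  have hsupp : Function.support A ⊆ ball 0 δ := by
    intro z hz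
    have h1 : radialBump (δ⁻¹ • z) ≠ 0 := right_ne_zero_of_mul hz
    have h2 := support_radialBump h1
    rw [mem_ball_zero_iff, norm_smul, norm_inv, Real.norm_of_nonneg hδ.le] at h2
    rw [mem_ball_zero_iff]
    rwa [inv_mul_lt_iff₀ hδ, mul_one] at h2
  refine ⟨A, contDiff_const.mul hcd, ?_, hsupp, fun z => ?_, ?_, fun z w h => ?_, ?_⟩
  · exact HasCompactSupport.of_support_subset_isCompact (isCompact_closedBall 0 δ)
      (hsupp.trans ball_subset_closedBall)
  · exact mul_nonneg (by positivity) (Real.smoothTransition.nonneg _)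
  · rw [hA, integral_const_mul, Measure.integral_comp_smul, Complex.finrank_real_complex, ← hN,
      abs_of_nonneg (by positivity), smul_eq_mul]
    field_simp
  · simp only [hA, radialBump, norm_smul, h]
  · have h1 : ∀ z, ‖fderiv ℝ A z‖ = (N⁻¹ * δ⁻¹ ^ 3) * ‖fderiv ℝ radialBump (δ⁻¹ • z)‖ := by
      intro z
      rw [hA, fderiv_const_mul (hcd.differentiable one_ne_zero z), fderiv_comp_smul, norm_smul,
        norm_smul, Real.norm_of_nonneg (by positivity), Real.norm_of_nonneg (by positivity)]
      ring
    simp only [h1]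
    rw [integral_const_mul, Measure.integral_comp_smul volume (fun z => ‖fderiv ℝ radialBump z‖),
      Complex.finrank_real_complex, ← hD, abs_of_nonneg (by positivity), smul_eq_mul]
    calc N⁻¹ * δ⁻¹ ^ 3 * ((δ⁻¹ ^ 2)⁻¹ * D) = N⁻¹ * D / δ := by field_simp
      _ ≤ (N⁻¹ * D + 1) / δ := by gcongr; linarith

/-- The mean value property for radial averages. -/
theorem integral_radial_mul_eq {A : ℂ → ℝ} {δ : ℝ} (hAc : Continuous A)
    (hsupp : Function.support A ⊆ ball 0 δ) (hint : ∫ z, A z = 1)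
    (hrad : ∀ z w, ‖z‖ = ‖w‖ → A z = A w) {f : ℂ → ℂ} (hf : Continuous f) {z : ℂ}
    (hfd : DifferentiableOn ℂ f (ball z δ)) : ∫ w, A w • f (z - w) = f z := by
  have hA0 : ∀ w, δ ≤ ‖w‖ → A w = 0 := by
    intro w hw
    by_contra h
    have := hsupp h
    rw [mem_ball_zero_iff] at this
    linarith
  have hcs : HasCompactSupport A := HasCompactSupport.of_support_subset_isCompact
    (isCompact_closedBall 0 δ) (hsupp.trans ball_subset_closedBall)
  have hi1 : Integrable fun w => A w • f (z - w) :=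
    (hAc.smul (by fun_prop)).integrable_of_hasCompactSupport hcs.smul_right
  have hi2 : Integrable fun w => A w • f z :=
    (hAc.smul (by fun_prop)).integrable_of_hasCompactSupport hcs.smul_right
  have hnorm : ∀ r θ : ℝ, ‖(r * unitVec θ : ℂ)‖ = |r| := by
    intro r θ; rw [norm_mul, norm_unitVec, Complex.norm_real, mul_one, Real.norm_eq_abs]
  have key : ∫ w, A w • (f (z - w) - f z) = 0 := by
    rw [integral_eq_polar (G := fun p => (p.1 : ℂ) * (A (p.1 * unitVec p.2) •
      (f (z - p.1 * unitVec p.2) - f z))) (R := |δ|)]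
    · refine setIntegral_eq_zero_of_forall_eq_zero fun r hr => ?_
      have hr' : 0 < r := hr
      by_cases hrδ : δ ≤ r
      · have : ∀ θ, A (r * unitVec θ) = 0 := fun θ => hA0 _ (by
          rw [hnorm, abs_of_pos hr']; exact hrδ)
        simp [this]
      · have h1 : ∀ θ, A (r * unitVec θ) = A r := fun θ => hrad _ _ (by
          rw [hnorm, Complex.norm_real, Real.norm_eq_abs])
        simp only [h1]
        rw [integral_const_mul, integral_smul]
        -- The mean of `f - f z` over a circle about `z` is zero. The radius is `-r` because the
        -- convolution evaluates `f` at `z - r e^{iθ}`.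
        have h2 : DiffContOnCl ℂ (fun w => f w - f z) (ball z |-r|) := by
          refine DifferentiableOn.diffContOnCl ?_
          refine (hfd.mono ?_).sub_const _
          rw [abs_neg, abs_of_pos hr']
          exact closure_ball_subset_closedBall.trans (closedBall_subset_ball (not_le.1 hrδ))
        have h3 := h2.circleAverage
        rw [Real.circleAverage_eq_integral_add (-π),
          intervalIntegral.integral_comp_add_right (fun θ ↦ f (circleMap z (-r) θ) - f z),
          sub_self, smul_eq_zero] at h3
        have h4 := h3.resolve_left (by positivity)
        rw [zero_add, show 2 * π + -π = π by ring, intervalIntegral.integral_of_le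
          (by linarith [pi_pos]), integral_Ioc_eq_integral_Ioo] at h4
        have h5 : ∀ θ : ℝ, circleMap z (-r) θ = z - r * unitVec θ := by
          intro θ; rw [circleMap, unitVec_eq_exp]; push_cast; ring
        simp only [h5] at h4
        rw [h4]; simp
    · have := continuous_unitVec
      fun_prop
    · intro p hp
      rw [hA0, zero_smul, mul_zero]
      rw [hnorm]
      exact (le_abs_self _).trans (hp.le.trans (le_abs_self _))
    · intro r θ _; rfl
  simp only [smul_sub] at key
  rw [integral_sub hi1 hi2, sub_eq_zero] at key
  rw [key, integral_smul_const, hint, one_smul]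

theorem dbar_eq_zero_of_differentiableAt {f : ℂ → ℂ} {z : ℂ} (hf : DifferentiableAt ℂ f z) :
    dbar f z = 0 := by
  have h := (differentiableAt_complex_iff_differentiableAt_real.1 hf).2
  rw [dbar, h, smul_eq_mul]
  linear_combination (fderiv ℝ f z 1) * Complex.I_mul_I

theorem norm_dbar_le (Φ : ℂ → ℂ) (z : ℂ) : ‖dbar Φ z‖ ≤ 2 * ‖fderiv ℝ Φ z‖ := by
  rw [dbar]
  refine (norm_add_le _ _).trans ?_
  rw [norm_mul, Complex.norm_I, one_mul]
  have h1 := (fderiv ℝ Φ z).le_opNorm 1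
  have h2 := (fderiv ℝ Φ z).le_opNorm Complex.I
  rw [norm_one] at h1
  rw [Complex.norm_I] at h2
  linarith

/-- The approximant is a convolution with a radial mollifier. Its gradient sees only the oscillation
of `f`, hence the bound `ε / δ`; radial averages reproduce holomorphic functions, so `dbar Φ`
vanishes where `f` is holomorphic on a disc of radius `2δ`. -/
theorem exists_smooth_approx : ∃ C : ℝ, 0 < C ∧ ∀ (f : ℂ → ℂ), Continuous f →
    HasCompactSupport f → ∀ δ ε : ℝ, 0 < δ → 0 ≤ ε →
    (∀ x y, dist x y < δ → dist (f x) (f y) ≤ ε) → ∃ Φ : ℂ → ℂ, ContDiff ℝ 1 Φ ∧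
    HasCompactSupport Φ ∧ (∀ z, ‖Φ z - f z‖ ≤ ε) ∧ (∀ z, ‖dbar Φ z‖ ≤ C * ε / δ) ∧
    ∀ z, DifferentiableOn ℂ f (ball z (2 * δ)) → dbar Φ z = 0 := by
  obtain ⟨C, hC, hmol⟩ := exists_radial_mollifier
  refine ⟨4 * C, by positivity, fun f hf hfc δ ε hδ hε hmod => ?_⟩
  obtain ⟨A, hAcd, hAcs, hAsupp, hA0, hAint, hArad, hAD⟩ := hmol (δ / 2) (by positivity)
  have hloc : LocallyIntegrable f volume := hf.locallyIntegrable
  set Φ : ℂ → ℂ := A ⋆[ContinuousLinearMap.lsmul ℝ ℝ, volume] f with hΦ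
  refine ⟨Φ, hAcs.contDiff_convolution_left _ hAcd hloc, hAcs.convolution _ hfc, fun z => ?_,
    fun z => ?_, fun z hz => ?_⟩
  · rw [← dist_eq_norm]
    exact dist_convolution_le hε hAsupp hA0 hAint hf.aestronglyMeasurable
      fun x hx => hmod _ _ ((mem_ball.1 hx).trans (by linarith))
  -- Subtracting the constant `f z` before differentiating leaves only differences of size at most
  -- `ε` in the integrand.
  · have hsplit : Φ = fun x => (A ⋆[ContinuousLinearMap.lsmul ℝ ℝ, volume]
        fun y => f y - f z) x + f z := by
      funext x
      simp only [hΦ, convolution_def, ContinuousLinearMap.lsmul_apply, smul_sub]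
      rw [integral_sub, integral_smul_const, hAint, one_smul, sub_add_cancel]
      · exact (hAcd.continuous.smul (by fun_prop)).integrable_of_hasCompactSupport hAcs.smul_right
      · exact (hAcd.continuous.smul (by fun_prop)).integrable_of_hasCompactSupport hAcs.smul_right
    have hder := (hAcs.hasFDerivAt_convolution_left (ContinuousLinearMap.lsmul ℝ ℝ) hAcd
      (g := fun y => f y - f z) (μ := volume)
      (by fun_prop : Continuous fun y => f y - f z).locallyIntegrable z).add_const (f z)
    rw [← hsplit] at hder
    refine (norm_dbar_le Φ z).trans ?_
    rw [hder.fderiv, convolution_def]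
    have h1 : ‖∫ t, ((ContinuousLinearMap.lsmul ℝ ℝ).precompL ℂ (fderiv ℝ A t)) (f (z - t) - f z)‖
        ≤ ∫ t, ‖fderiv ℝ A t‖ * ε := by
      refine norm_integral_le_of_norm_le ?_ (Filter.Eventually.of_forall fun t => ?_)
      · refine Integrable.mul_const ?_ _
        exact ((hAcd.continuous_fderiv one_ne_zero).integrable_of_hasCompactSupport
          (hAcs.fderiv ℝ)).norm
      · by_cases ht : fderiv ℝ A t = 0
        · simp [ht]
        · refine ContinuousLinearMap.opNorm_le_bound _ (by positivity) fun w => ?_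
          rw [ContinuousLinearMap.precompL_apply, ContinuousLinearMap.lsmul_apply, norm_smul]
          have ht' : t ∈ closedBall (0 : ℂ) (δ / 2) :=
            closure_minimal (hAsupp.trans ball_subset_closedBall) isClosed_closedBall
              (support_fderiv_subset ℝ ht)
          rw [mem_closedBall_zero_iff] at ht'
          have h2 : ‖f (z - t) - f z‖ ≤ ε := by
            rw [← dist_eq_norm]
            refine hmod _ _ ?_
            rw [dist_eq_norm]
            simpa using lt_of_le_of_lt ht' (by linarith)
          calc ‖fderiv ℝ A t w‖ * ‖f (z - t) - f z‖ ≤ (‖fderiv ℝ A t‖ * ‖w‖) * ε := by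
                gcongr; exact (fderiv ℝ A t).le_opNorm w
            _ = ‖fderiv ℝ A t‖ * ε * ‖w‖ := by ring
    rw [integral_mul_const] at h1
    calc 2 * _ ≤ 2 * (C / (δ / 2) * ε) := by
          gcongr
          exact h1.trans (by gcongr)
      _ = 4 * C * ε / δ := by field_simp; ring
  -- The averaging discs of radius `δ / 2` about points within `δ` of `z` stay inside the disc of
  -- radius `2δ`.
  · have heq : Φ =ᶠ[nhds z] f := by
      filter_upwards [ball_mem_nhds z hδ] with x hx
      refine integral_radial_mul_eq hAcd.continuous hAsupp hAint hArad hf (hz.mono ?_)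
      refine ball_subset_ball' ?_
      rw [mem_ball] at hx
      linarith
    have hfz : DifferentiableAt ℂ f z :=
      (hz z (mem_ball_self (by linarith))).differentiableAt (ball_mem_nhds _ (by linarith))
    have := dbar_eq_zero_of_differentiableAt hfz
    rwa [dbar, ← heq.fderiv_eq] at this

end Mollification

/-! ### Mergelyan's theorem for star-shaped compact sets -/

section Mergelyan

open MeasureTheory Set Real Metric

/-- For `δ = 1` the radial integrand is `1 / (1 + r²)`. The general case scales like `δ`, which
later cancels the `1 / δ` in the bound for `dbar Φ`. -/
theorem exists_integral_kernelMajorant_le : ∃ C : ℝ, 0 < C ∧ ∀ δ : ℝ, 0 < δ →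
    Integrable (fun u : ℂ => kernelMajorant δ ‖u‖) ∧ ∫ u : ℂ, kernelMajorant δ ‖u‖ ≤ C * δ := by
  have h1 : Integrable fun u : ℂ => kernelMajorant 1 ‖u‖ := by
    rw [integrable_fun_norm_addHaar, Complex.finrank_real_complex]
    refine integrable_inv_one_add_sq.integrableOn.congr_fun (fun r hr => ?_) measurableSet_Ioi
    have hr' : r ≠ 0 := ne_of_gt hr
    simp only [kernelMajorant, smul_eq_mul]
    field_simp
    simp
  have h0 : 0 ≤ ∫ u : ℂ, kernelMajorant 1 ‖u‖ :=
    integral_nonneg fun u => by unfold kernelMajorant; positivity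
  refine ⟨(∫ u : ℂ, kernelMajorant 1 ‖u‖) + 1, by positivity, fun δ hδ => ?_⟩
  have h2 : ∀ u : ℂ, kernelMajorant δ ‖u‖ = δ⁻¹ * kernelMajorant 1 ‖δ⁻¹ • u‖ := by
    intro u
    rw [norm_smul, norm_inv, Real.norm_of_nonneg hδ.le, kernelMajorant, kernelMajorant]
    rcases eq_or_ne ‖u‖ 0 with h | h
    · simp [h]
    · field_simp
  simp only [h2]
  refine ⟨(h1.comp_smul (inv_ne_zero hδ.ne')).const_mul _, ?_⟩
  rw [integral_const_mul, Measure.integral_comp_smul volume (fun u : ℂ => kernelMajorant 1 ‖u‖),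
    Complex.finrank_real_complex, abs_of_nonneg (by positivity), smul_eq_mul]
  calc _ = (∫ u : ℂ, kernelMajorant 1 ‖u‖) * δ := by field_simp
    _ ≤ _ := by nlinarith

/-- The Cauchy-Pompeiu formula for compactly supported functions. -/
theorem integral_dbar_mul_cauchyKernel {Φ : ℂ → ℂ} (hΦ : ContDiff ℝ 1 Φ)
    (hc : HasCompactSupport Φ) (z : ℂ) : ∫ ζ, dbar Φ ζ * (1 / (z - ζ)) = 2 * π * Φ z := by
  have h := integral_dbar_div (Φ := fun ζ => Φ (z + ζ)) (hΦ.comp (by fun_prop))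
    (hc.comp_homeomorph (Homeomorph.addLeft z))
  have h1 : ∀ ζ, dbar (fun ζ => Φ (z + ζ)) ζ / ζ
      = (fun ζ => -(dbar Φ ζ * (1 / (z - ζ)))) (z + ζ) := by
    intro ζ
    simp only [dbar, fderiv_comp_add_left]
    rw [show z - (z + ζ) = -ζ by ring, one_div, inv_neg, div_eq_mul_inv]
    ring
  simp only [h1] at h
  rw [integral_add_left_eq_self (fun ζ => -(dbar Φ ζ * (1 / (z - ζ)))) z, integral_neg] at h
  simp only [add_zero] at h
  linear_combination -h

theorem continuous_dbar {Φ : ℂ → ℂ} (hΦ : ContDiff ℝ 1 Φ) : Continuous (dbar Φ) := by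
  have := hΦ.continuous_fderiv one_ne_zero
  unfold dbar
  fun_prop

theorem hasCompactSupport_dbar {Φ : ℂ → ℂ} (hc : HasCompactSupport Φ) :
    HasCompactSupport (dbar Φ) := by
  refine (hc.fderiv ℝ).mono fun z hz h => hz ?_
  simp [dbar, h]

/-- A function that is continuous on a compact set extends to a compactly supported continuous
function on the plane. -/
theorem exists_continuous_extension {K : Set ℂ} (hK : IsCompact K) {F : ℂ → ℂ}
    (hF : ContinuousOn F K) : ∃ f : ℂ → ℂ, Continuous f ∧ HasCompactSupport f ∧ EqOn f F K := by
  obtain ⟨g, hg⟩ := ContinuousMap.exists_restrict_eq hK.isClosed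
    (⟨K.domRestrict F, hF.domRestrict⟩ : C(K, ℂ))
  obtain ⟨R, hR0, hR⟩ := hK.isBounded.exists_pos_norm_le
  refine ⟨fun z => ((max 0 (min 1 (R + 1 - ‖z‖)) : ℝ) : ℂ) * g z, by fun_prop, ?_, ?_⟩
  · refine HasCompactSupport.intro (isCompact_closedBall 0 (R + 1)) fun z hz => ?_
    rw [mem_closedBall_zero_iff, not_le] at hz
    rw [max_eq_left (min_le_of_right_le (by linarith))]
    simp
  · intro z hz
    have h1 : g z = F z := congrArg (fun φ : C(K, ℂ) => φ ⟨z, hz⟩) hg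
    have h2 := hR z hz
    simp only
    rw [min_eq_left (by linarith), max_eq_right (by norm_num), h1]
    simp

/-- For `p` outside a compact set that is star-shaped with respect to the origin, the radial
segment of length `2 δ` that starts in `p` avoids the set. -/
theorem notMem_unitSlit_of_star {K : Set ℂ}
    (hstar : ∀ z ∈ K, ∀ t : ℝ, 0 ≤ t → t ≤ 1 → (t : ℂ) * z ∈ K) {p : ℂ} (hp : p ∉ K) (hp0 : p ≠ 0)
    {δ : ℝ} (hδ : 0 < δ) {z : ℂ} (hz : z ∈ K) :
    (z - (p + (δ / ‖p‖ : ℝ) * p)) / ((δ / ‖p‖ : ℝ) * p) ∉ unitSlit := by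
  rintro ⟨t, ⟨ht1, ht2⟩, ht⟩
  have hpn : 0 < ‖p‖ := norm_pos_iff.2 hp0
  have hd : ((δ / ‖p‖ : ℝ) : ℂ) * p ≠ 0 :=
    mul_ne_zero (by exact_mod_cast (by positivity)) hp0
  have h1 : z = ((1 + (1 + t) * (δ / ‖p‖) : ℝ) : ℂ) * p := by
    simp only at ht
    rw [eq_div_iff hd] at ht
    push_cast at ht ⊢
    linear_combination -ht
  have h2 : (1 : ℝ) ≤ 1 + (1 + t) * (δ / ‖p‖) := by
    have : 0 ≤ (1 + t) * (δ / ‖p‖) := mul_nonneg (by linarith) (by positivity)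
    linarith
  have h3 := hstar z hz (1 + (1 + t) * (δ / ‖p‖))⁻¹ (by positivity) (inv_le_one_of_one_le₀ h2)
  rw [h1, ← mul_assoc, ← Complex.ofReal_mul, inv_mul_cancel₀ (by positivity), Complex.ofReal_one,
    one_mul] at h3
  exact hp h3

/-- Integrals against a kernel that depends on the variable of integration through a simple
function are finite sums. -/
theorem integral_mul_mergelyanKernel (N : SimpleFunc ℂ ℂ) (m d : ℂ → ℂ) {ψ : ℂ → ℂ}
    (hψ : Continuous ψ) (hc : HasCompactSupport ψ) : ∃ a b : ℂ → ℂ, ∀ z,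
    Integrable (fun ζ => ψ ζ * mergelyanKernel (m (N ζ)) (d (N ζ)) ζ z) ∧
    ∫ ζ, ψ ζ * mergelyanKernel (m (N ζ)) (d (N ζ)) ζ z = ∑ p ∈ N.range,
      (a p * slitKernel (m p) (d p) z + b p * slitKernel (m p) (d p) z ^ 2) := by
  have h1 : ∀ p, Integrable ((N ⁻¹' {p}).indicator ψ) := fun p =>
    (hψ.integrable_of_hasCompactSupport hc).indicator (N.measurableSet_fiber p)
  have h2 : ∀ p, Integrable ((N ⁻¹' {p}).indicator fun ζ => ψ ζ * (ζ - m p)) := fun p =>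
    (Continuous.integrable_of_hasCompactSupport (by fun_prop) hc.mul_right).indicator
      (N.measurableSet_fiber p)
  refine ⟨fun p => ∫ ζ, (N ⁻¹' {p}).indicator ψ ζ,
    fun p => ∫ ζ, (N ⁻¹' {p}).indicator (fun ζ => ψ ζ * (ζ - m p)) ζ, fun z => ?_⟩
  have h3 : ∀ ζ, ψ ζ * mergelyanKernel (m (N ζ)) (d (N ζ)) ζ z = ∑ p ∈ N.range,
      ((N ⁻¹' {p}).indicator ψ ζ * slitKernel (m p) (d p) z
        + (N ⁻¹' {p}).indicator (fun ζ => ψ ζ * (ζ - m p)) ζ * slitKernel (m p) (d p) z ^ 2) := by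
    intro ζ
    rw [Finset.sum_eq_single (N ζ)]
    · simp only [mergelyanKernel, mem_preimage, mem_singleton_iff, indicator_of_mem]
      ring
    · intro p _ hp
      have : ζ ∉ N ⁻¹' {p} := fun h => hp h.symm
      simp [indicator_of_notMem this]
    · intro h
      exact absurd (N.mem_range_self ζ) h
  have h4 : ∀ p ∈ N.range, Integrable fun ζ =>
      ((N ⁻¹' {p}).indicator ψ ζ * slitKernel (m p) (d p) z
        + (N ⁻¹' {p}).indicator (fun ζ => ψ ζ * (ζ - m p)) ζ * slitKernel (m p) (d p) z ^ 2) :=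
    fun p _ => ((h1 p).mul_const _).add ((h2 p).mul_const _)
  simp only [h3]
  refine ⟨integrable_finsetSum _ h4, ?_⟩
  rw [integral_finsetSum _ h4]
  refine Finset.sum_congr rfl fun p _ => ?_
  rw [integral_add ((h1 p).mul_const _) ((h2 p).mul_const _), integral_mul_const,
    integral_mul_const]

/-- Mergelyan's theorem for compact sets that are star-shaped with respect to the origin. -/
theorem PolyApprox.of_continuousOn_of_star {K : Set ℂ} (hK : IsCompact K)
    (hstar : ∀ z ∈ K, ∀ t : ℝ, 0 ≤ t → t ≤ 1 → (t : ℂ) * z ∈ K) {F : ℂ → ℂ}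
    (hF : ContinuousOn F K) (hFd : DifferentiableOn ℂ F (interior K)) : PolyApprox K F := by
  rcases K.eq_empty_or_nonempty with rfl | ⟨z₀, hz₀⟩
  · exact fun ε _ => ⟨0, fun z hz => hz.elim⟩
  have h0K : (0 : ℂ) ∈ K := by simpa using hstar z₀ hz₀ 0 le_rfl zero_le_one
  obtain ⟨f, hf, hfc, hfF⟩ := exists_continuous_extension hK hF
  obtain ⟨C₁, hC₁, hsmooth⟩ := exists_smooth_approx
  obtain ⟨C₂, hC₂, hmaj⟩ := exists_integral_kernelMajorant_le
  refine PolyApprox.of_approx fun ε hε => ?_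
  -- The product accounts for the change of kernel, the summand `1` for the smoothing.
  set C₃ : ℝ := (2 * π)⁻¹ * (C₁ * 30000 * C₂) + 1 with hC₃
  have hC₃0 : 0 < C₃ := by positivity
  set ε' : ℝ := ε / (2 * C₃) with hε'
  have hε'0 : 0 < ε' := by positivity
  obtain ⟨δ, hδ, hmod⟩ := Metric.uniformContinuous_iff.1
    (hfc.uniformContinuous_of_continuous hf) ε' hε'0
  obtain ⟨Φ, hΦ, hΦc, hΦf, hΦd, hΦ0⟩ := hsmooth f hf hfc δ ε' hδ hε'0.le
    fun x y h => (hmod h).le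
  have hψ := continuous_dbar hΦ
  have hψc := hasCompactSupport_dbar hΦc
  have hne : Nonempty (Kᶜ : Set ℂ) := by
    obtain ⟨R, hR⟩ := hK.isBounded.exists_norm_le
    refine ⟨⟨((|R| + 1 : ℝ) : ℂ), fun h => ?_⟩⟩
    have h1 := hR _ h
    rw [Complex.norm_real, Real.norm_of_nonneg (by positivity)] at h1
    linarith [le_abs_self R]
  set e : ℕ → ℂ := fun k => (TopologicalSpace.denseSeq (Kᶜ : Set ℂ) k : ℂ) with he
  have heK : ∀ k, e k ∉ K := fun k => (TopologicalSpace.denseSeq (Kᶜ : Set ℂ) k).2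
  -- If the disc of radius `2δ` about `ζ` were inside `K`, then `f` would be holomorphic there and
  -- `dbar Φ ζ` would vanish.
  have hnear : ∀ ζ ∈ Function.support (dbar Φ), ∃ k, dist (e k) ζ < 2 * δ := by
    intro ζ hζ
    have h1 : ¬ ball ζ (2 * δ) ⊆ K := by
      intro h
      refine hζ (hΦ0 ζ ?_)
      have h2 : ball ζ (2 * δ) ⊆ interior K := interior_maximal h isOpen_ball
      exact (hFd.mono h2).congr fun w hw => hfF (h hw)
    obtain ⟨w, hw, hwK⟩ := not_subset.1 h1
    obtain ⟨k, hk⟩ := (TopologicalSpace.denseRange_denseSeq (Kᶜ : Set ℂ)).exists_dist_lt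
      (⟨w, hwK⟩ : (Kᶜ : Set ℂ)) (sub_pos.2 (mem_ball.1 hw))
    refine ⟨k, ?_⟩
    have h3 : dist (e k) w < 2 * δ - dist w ζ := by rw [dist_comm]; exact hk
    linarith [dist_triangle (e k) w ζ]
  obtain ⟨N, hN⟩ : ∃ N : ℕ, ∀ ζ ∈ tsupport (dbar Φ), ∃ k ≤ N, dist (e k) ζ < 3 * δ := by
    obtain ⟨t, ht⟩ := hψc.isCompact.elim_finite_subcover (fun k => ball (e k) (3 * δ))
      (fun _ => isOpen_ball) (fun ζ hζ => by
        obtain ⟨ζ', hζ', hd⟩ := Metric.mem_closure_iff.1 hζ δ hδ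
        obtain ⟨k, hk⟩ := hnear ζ' hζ'
        refine mem_iUnion.2 ⟨k, ?_⟩
        rw [mem_ball, dist_comm]
        rw [dist_comm] at hd
        linarith [dist_triangle (e k) ζ' ζ])
    refine ⟨t.sup id, fun ζ hζ => ?_⟩
    obtain ⟨k, hk, hkζ⟩ := mem_iUnion₂.1 (ht hζ)
    exact ⟨k, Finset.le_sup (f := id) hk, by rw [dist_comm]; exact mem_ball.1 hkζ⟩
  -- A measurable, finitely valued choice of a point outside `K`, within `3δ` of `ζ` on the support.
  -- The slit at `P ζ` has its midpoint at distance `δ` from `P ζ`, hence within `4δ` of `ζ`.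
  set P : SimpleFunc ℂ ℂ := SimpleFunc.nearestPt e N with hP
  have hPK : ∀ ζ, P ζ ∉ K := fun ζ => heK _
  have hP0 : ∀ ζ, P ζ ≠ 0 := fun ζ h => hPK ζ (h ▸ h0K)
  have hPd : ∀ ζ ∈ tsupport (dbar Φ), dist (P ζ) ζ < 3 * δ := by
    intro ζ hζ
    obtain ⟨k, hk, hkζ⟩ := hN ζ hζ
    refine lt_of_le_of_lt ?_ hkζ
    have := SimpleFunc.edist_nearestPt_le e ζ hk
    rwa [edist_dist, edist_dist, ENNReal.ofReal_le_ofReal_iff dist_nonneg] at this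
  set d : ℂ → ℂ := fun p => (δ / ‖p‖ : ℝ) * p with hd
  set m : ℂ → ℂ := fun p => p + d p with hm
  have hdn : ∀ p, p ≠ 0 → ‖d p‖ = δ := by
    intro p hp
    have : ‖p‖ ≠ 0 := norm_ne_zero_iff.2 hp
    rw [hd, norm_mul, Complex.norm_real, Real.norm_of_nonneg (by positivity)]
    field_simp
  obtain ⟨a, b, hab⟩ := integral_mul_mergelyanKernel P m d hψ hψc
  set G : ℂ → ℂ := fun z => (2 * π : ℂ)⁻¹ * ∑ p ∈ P.range,
      (a p * slitKernel (m p) (d p) z + b p * slitKernel (m p) (d p) z ^ 2) with hG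
  have hrange : ∀ p ∈ P.range, p ∉ K := by
    intro p hp
    obtain ⟨ζ, rfl⟩ := SimpleFunc.mem_range.1 hp
    exact hPK ζ
  refine ⟨G, ?_, fun z hz => ?_⟩
  -- `G` is a finite combination of slit kernels, holomorphic on the open complement of finitely
  -- many slits that miss `K`.
  · refine PolyApprox.of_differentiableOn hK
      (U := ⋂ p ∈ P.range, (fun z => (z - m p) / d p) ⁻¹' unitSlitᶜ) ?_ ?_ hstar ?_
    · exact isOpen_biInter_finset fun p _ =>
        isClosed_unitSlit.isOpen_compl.preimage (by fun_prop)
    · intro z hz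
      refine mem_iInter₂.2 fun p hp => ?_
      exact notMem_unitSlit_of_star hstar (hrange p hp)
        (fun h => hrange p hp (h ▸ h0K)) hδ hz
    · intro z hz
      refine DifferentiableAt.differentiableWithinAt ?_
      refine (differentiableAt_const _).mul (DifferentiableAt.fun_sum fun p hp => ?_)
      have := differentiableAt_slitKernel (mem_iInter₂.1 hz p hp)
      fun_prop
  · obtain ⟨hi, hint⟩ := hab z
    obtain ⟨hki, hkint⟩ := hmaj δ hδ
    have hbd : ∀ᵐ ζ : ℂ, ‖dbar Φ ζ * mergelyanKernel (m (P ζ)) (d (P ζ)) ζ z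
        - dbar Φ ζ * (1 / (z - ζ))‖ ≤ C₁ * ε' / δ * 30000 * kernelMajorant δ ‖z - ζ‖ := by
      have : ∀ᵐ ζ : ℂ, ζ ≠ z := by simp [ae_iff]
      filter_upwards [this] with ζ hζz
      rw [← mul_sub, norm_mul]
      have hk0 : 0 ≤ kernelMajorant δ ‖z - ζ‖ := by unfold kernelMajorant; positivity
      by_cases hζ : dbar Φ ζ = 0
      · rw [hζ, norm_zero, zero_mul]; positivity
      · have h1 := norm_mergelyanKernel_sub_le (m := m (P ζ)) (d := d (P ζ)) (z := z) (ζ := ζ)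
          (norm_ne_zero_iff.1 (by rw [hdn _ (hP0 ζ)]; exact hδ.ne'))
          (notMem_unitSlit_of_star hstar (hPK ζ) (hP0 ζ) hδ hz) ?_ hζz.symm
        · rw [hdn _ (hP0 ζ)] at h1
          calc _ ≤ C₁ * ε' / δ * (30000 * kernelMajorant δ ‖z - ζ‖) := by
                gcongr; exact hΦd ζ
            _ = _ := by ring
        · have h2 := hPd ζ (subset_tsupport _ hζ)
          rw [dist_comm, dist_eq_norm] at h2
          rw [hm]
          simp only
          rw [← sub_sub]
          refine (norm_sub_le _ _).trans ?_
          rw [hdn _ (hP0 ζ)]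
          linarith
    have hki' : Integrable fun ζ : ℂ => C₁ * ε' / δ * 30000 * kernelMajorant δ ‖z - ζ‖ :=
      (hki.comp_sub_left z).const_mul _
    have hmeas : AEStronglyMeasurable (fun ζ => dbar Φ ζ * (1 / (z - ζ))) volume := by
      have : Measurable fun ζ : ℂ => 1 / (z - ζ) := by fun_prop
      exact (hψ.measurable.mul this).aestronglyMeasurable
    have hdiff := hki'.mono' (hi.aestronglyMeasurable.sub hmeas) hbd
    have hi2 : Integrable fun ζ => dbar Φ ζ * (1 / (z - ζ)) :=
      (hi.sub hdiff).congr (Filter.Eventually.of_forall fun ζ => by simp)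
    have h1 : G z - Φ z = (2 * π : ℂ)⁻¹ * ∫ ζ, (dbar Φ ζ * mergelyanKernel (m (P ζ)) (d (P ζ)) ζ z
        - dbar Φ ζ * (1 / (z - ζ))) := by
      rw [integral_sub hi hi2, hint, integral_dbar_mul_cauchyKernel hΦ hΦc, hG, mul_sub]
      have : (2 * π : ℂ) ≠ 0 := by exact_mod_cast (by positivity)
      rw [← mul_assoc, inv_mul_cancel₀ this, one_mul]
    have h2 : ‖G z - Φ z‖ ≤ (2 * π)⁻¹ * (C₁ * 30000 * C₂) * ε' := by
      rw [h1, norm_mul]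
      have h3 := norm_integral_le_of_norm_le hki' hbd
      rw [integral_const_mul, integral_sub_left_eq_self (fun u : ℂ => kernelMajorant δ ‖u‖)] at h3
      have h4 : ‖(2 * π : ℂ)⁻¹‖ = (2 * π)⁻¹ := by
        rw [norm_inv, norm_mul, Complex.norm_ofNat, Complex.norm_real,
          Real.norm_of_nonneg pi_pos.le]
      rw [h4]
      calc _ ≤ (2 * π)⁻¹ * (C₁ * ε' / δ * 30000 * (C₂ * δ)) := by
            gcongr
            exact h3.trans (by gcongr)
        _ = _ := by field_simp
    have h5 := hΦf z
    rw [hfF hz] at h5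
    have h6 : ‖F z - G z‖ ≤ C₃ * ε' := by
      have h7 : F z - G z = -(G z - Φ z) - (Φ z - F z) := by ring
      rw [h7]
      refine (norm_sub_le _ _).trans ?_
      rw [norm_neg, hC₃, add_mul, one_mul]
      linarith
    have h8 : C₃ * ε' = ε / 2 := by rw [hε']; field_simp
    linarith

/-- Mergelyan's theorem for star-shaped compact sets. -/
theorem PolyApprox.of_starConvex {K : Set ℂ} (hK : IsCompact K) {c : ℂ} (hstar : StarConvex ℝ c K)
    {F : ℂ → ℂ} (hF : ContinuousOn F K) (hFd : DifferentiableOn ℂ F (interior K)) :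
    PolyApprox K F := by
  have hmem : ∀ z, z ∈ (Homeomorph.addRight c) ⁻¹' K ↔ z + c ∈ K := fun z => Iff.rfl
  have hcomp : PolyApprox ((Homeomorph.addRight c) ⁻¹' K) fun z => F (z + c) := by
    refine PolyApprox.of_continuousOn_of_star ?_ ?_ ?_ ?_
    · exact (Homeomorph.isCompact_preimage _).2 hK
    · intro z hz t ht0 ht1
      rw [hmem] at hz ⊢
      have := hstar hz (sub_nonneg.2 ht1) ht0 (by ring)
      simp only [Complex.real_smul] at this
      convert this using 1
      push_cast
      ring
    · exact hF.comp (by fun_prop) fun z hz => hz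
    · rw [← Homeomorph.preimage_interior]
      exact hFd.comp (by fun_prop) fun z hz => hz
  intro ε hε
  obtain ⟨p, hp⟩ := hcomp ε hε
  refine ⟨p.comp (Polynomial.X - Polynomial.C c), fun z hz => ?_⟩
  have := hp (z - c) (by rw [hmem]; simpa using hz)
  simpa [Polynomial.eval_comp] using this

end Mergelyan

/-! ### Star-shaped Jordan regions have no boundary slits -/

section JordanStar

open Set Metric

theorem Circle.isPreconnected_compl_singleton (x : Circle) : IsPreconnected ({x}ᶜ : Set Circle) := by
  have h : ({x}ᶜ : Set Circle)
      = (fun t : ℝ => x * Circle.exp (Real.pi + t)) '' Ioo (-Real.pi) Real.pi := by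
    ext y
    constructor
    · intro hy
      set u : Circle := y / (x * Circle.exp Real.pi) with hu
      have huy : y = x * Circle.exp Real.pi * u := by rw [hu]; simp
      have harg : u = Circle.exp (Complex.arg u) := (Circle.exp_arg u).symm
      refine ⟨Complex.arg u, ⟨Complex.neg_pi_lt_arg _, lt_of_le_of_ne (Complex.arg_le_pi _) ?_⟩, ?_⟩
      · intro hpi
        rw [hpi] at harg
        apply hy
        rw [mem_singleton_iff, huy, harg, mul_assoc, ← Circle.exp_add, ← two_mul,
          Circle.exp_two_pi, mul_one]
      · simp only
        rw [Circle.exp_add, ← mul_assoc, ← harg, ← huy]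
    · rintro ⟨t, ⟨ht1, ht2⟩, rfl⟩ hx
      simp only [mem_singleton_iff, mul_eq_left] at hx
      have h1 : Circle.exp t = Circle.exp Real.pi := by
        have h2 : Circle.exp (2 * Real.pi) = 1 := Circle.exp_two_pi
        rw [two_mul, ← hx, Circle.exp_add, Circle.exp_add] at h2
        exact (mul_left_cancel h2).symm
      have h2 := Circle.arg_exp (x := t) ht1 ht2.le
      have h3 := Circle.arg_exp (x := Real.pi) (by linarith) le_rfl
      rw [h1, h3] at h2
      linarith
  rw [h]
  exact isPreconnected_Ioo.image _ (by fun_prop)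

/-- The normalized situation of `StarConvex.interior_closure_subset`: no boundary segment
`[a, 1]` of a star-shaped Jordan region ends in an interior point of the closure. -/
theorem false_of_one_mem_interior_closure {D : Set ℂ} (hD : IsOpen D) (h0 : (0 : ℂ) ∈ D)
    (hstar : ∀ z ∈ D, ∀ t : ℝ, 0 ≤ t → t ≤ 1 → (t : ℂ) * z ∈ D) {γ : Circle → ℂ}
    (hγ : Continuous γ) (hinj : Function.Injective γ) (hrange : range γ = frontier D)
    {a : ℝ} (ha0 : 0 < a) (ha1 : a < 1) (haD : (a : ℂ) ∉ D)
    (h1 : (1 : ℂ) ∈ interior (closure D)) : False := by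
  have hΓD : ∀ z ∈ frontier D, z ∉ D := fun z hz => by
    rw [hD.frontier_eq] at hz; exact hz.2
  have hΓ : ∀ z ∈ closure D, z ∉ D → z ∈ frontier D := fun z hz hzD => by
    rw [hD.frontier_eq]; exact ⟨hz, hzD⟩
  have hray : ∀ s t : ℝ, 0 < s → s ≤ t → (s : ℂ) ∉ D → (t : ℂ) ∉ D := by
    intro s t hs hst hsD htD
    have ht : 0 < t := hs.trans_le hst
    have := hstar _ htD (s / t) (by positivity) ((div_le_one ht).2 hst)
    rw [← Complex.ofReal_mul, div_mul_cancel₀ _ ht.ne'] at this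
    exact hsD this
  have hstarcl : ∀ z ∈ closure D, ∀ t : ℝ, 0 ≤ t → t ≤ 1 → (t : ℂ) * z ∈ closure D := by
    intro z hz t ht0 ht1
    exact map_mem_closure (f := fun z => (t : ℂ) * z) (by fun_prop) hz
      fun w hw => hstar w hw t ht0 ht1
  have h1D : (1 : ℂ) ∉ D := by simpa using hray a 1 ha0 ha1.le haD
  have h1Γ : (1 : ℂ) ∈ frontier D := hΓ _ (interior_subset h1) h1D
  obtain ⟨x, hx⟩ : ∃ x, γ x = 1 := by rw [← mem_range, hrange]; exact h1Γ
  obtain ⟨r', hr', hball'⟩ := Metric.isOpen_iff.1 isOpen_interior _ h1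
  set r : ℝ := min r' (1 / 2) with hr
  have hr0 : 0 < r := by positivity
  have hr2 : r ≤ 1 / 2 := min_le_right _ _
  have hball : ball (1 : ℂ) r ⊆ closure D :=
    (ball_subset_ball (min_le_left _ _)).trans (hball'.trans interior_subset)
  have hemb : Topology.IsClosedEmbedding γ := hγ.isClosedEmbedding hinj
  -- a connected neighbourhood of `1` in the boundary curve
  have : LocallyConnectedSpace Circle :=
    ChartedSpace.locallyConnectedSpace (EuclideanSpace ℝ (Fin 1)) Circle
  obtain ⟨V, hVsub, hVopen, hxV, hVconn⟩ := locallyConnectedSpace_iff_subsets_isOpen_isConnected.1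
    this x (γ ⁻¹' ball 1 (r / 4))
    ((hγ.tendsto x) (by rw [hx]; exact ball_mem_nhds _ (by positivity)))
  obtain ⟨O, hO, hOV⟩ := hemb.isInducing.isOpen_iff.1 hVopen
  set N : Set ℂ := γ '' V with hN
  have hNconn : IsPreconnected N := hVconn.isPreconnected.image _ hγ.continuousOn
  have hNball : ∀ z ∈ N, ‖z - 1‖ < r / 4 := by
    rintro _ ⟨y, hy, rfl⟩
    have := hVsub hy
    rwa [mem_preimage, mem_ball, dist_eq_norm] at this
  have hre_le : ∀ z : ℂ, |z.re - 1| ≤ ‖z - 1‖ := fun z => by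
    simpa using Complex.abs_re_le_norm (z - 1)
  have hNre : ∀ z ∈ N, 0 < z.re ∧ z.re < 1 + r / 4 := by
    intro z hz
    have := abs_lt.1 ((hre_le z).trans_lt (hNball z hz))
    constructor <;> linarith
  have hNΓ : ∀ z ∈ N, z ∈ frontier D := by
    rintro _ ⟨y, hy, rfl⟩
    rw [← hrange]; exact mem_range_self y
  have h1N : (1 : ℂ) ∈ N := ⟨x, hxV, hx⟩
  have hslope : ContinuousOn (fun z : ℂ => z.im / z.re) {z | 0 < z.re} :=
    Complex.continuous_im.continuousOn.div Complex.continuous_re.continuousOn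
      fun z hz => (ne_of_gt hz)
  -- the curve is contained in the real axis near `1`
  have hNreal : ∀ z ∈ N, z.im = 0 := by
    intro z₁ hz₁
    by_contra him
    set s₁ : ℝ := z₁.im / z₁.re with hs₁
    have hs₁0 : s₁ ≠ 0 := div_ne_zero him (hNre z₁ hz₁).1.ne'
    have hσ : ContinuousOn (fun z : ℂ => z.im / z.re / s₁) {z | 0 < z.re} :=
      hslope.div_const _
    -- The arc `N` joins slope `0` to slope `s₁`, so it meets every ray of intermediate slope.
    have hIcc : Icc 0 1 ⊆ (fun z : ℂ => z.im / z.re / s₁) '' N := by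
      have := hNconn.intermediate_value h1N hz₁ (hσ.mono fun z hz => (hNre z hz).1)
      simpa [← hs₁, div_self hs₁0] using this
    -- The slope `l s₁` is small enough for `y₀`, beyond `N` at real part `1 + r / 2`, to lie in the
    -- disc of radius `r`. A point of `D` near `y₀` has a point of `N` on its ray closer to the
    -- origin, so star-shapedness puts a boundary point in `D`.
    set l : ℝ := min (1 / 2) (r / (8 * |s₁|)) with hl
    have hl0 : 0 < l := by positivity
    have hls : l * |s₁| ≤ r / 8 := by
      calc l * |s₁| ≤ r / (8 * |s₁|) * |s₁| := by gcongr; exact min_le_right _ _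
        _ = r / 8 := by field_simp
    set y₀ : ℂ := ⟨1 + r / 2, (1 + r / 2) * (l * s₁)⟩ with hy₀
    have hy₀re : y₀.re = 1 + r / 2 := rfl
    have hy₀im : y₀.im = (1 + r / 2) * (l * s₁) := rfl
    have hy₀pos : 0 < y₀.re := by rw [hy₀re]; positivity
    have hy₀ball : y₀ ∈ closure D := by
      refine hball ?_
      rw [mem_ball, dist_eq_norm]
      refine (Complex.norm_le_abs_re_add_abs_im _).trans_lt ?_
      rw [Complex.sub_re, Complex.sub_im, hy₀re, hy₀im, Complex.one_re, Complex.one_im, sub_zero,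
        add_sub_cancel_left, abs_of_pos (by positivity), abs_mul, abs_mul, abs_of_pos hl0,
        abs_of_pos (by positivity : 0 < 1 + r / 2)]
      nlinarith
    have hσy₀ : y₀.im / y₀.re / s₁ = l := by
      rw [hy₀re, hy₀im]; field_simp
    have hopen : IsOpen ({z : ℂ | 0 < z.re} ∩ (fun z : ℂ => z.im / z.re / s₁) ⁻¹' Ioo 0 1) :=
      hσ.isOpen_inter_preimage (isOpen_lt continuous_const Complex.continuous_re) isOpen_Ioo
    have hopen2 : IsOpen {z : ℂ | 1 + r / 4 < z.re} :=
      isOpen_lt continuous_const Complex.continuous_re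
    obtain ⟨y, ⟨⟨hy1, hy2⟩, hy3⟩, hyD⟩ := mem_closure_iff.1 hy₀ball _ (hopen.inter hopen2)
      ⟨⟨hy₀pos, by
        rw [mem_preimage, hσy₀]
        exact ⟨hl0, (min_le_left _ _).trans_lt (by norm_num)⟩⟩, by
        change 1 + r / 4 < y₀.re
        rw [hy₀re]; linarith⟩
    obtain ⟨z, hzN, hz⟩ := hIcc (Ioo_subset_Icc_self hy2)
    obtain ⟨hz0, hz1⟩ := hNre z hzN
    have hy1' : 0 < y.re := hy1
    have hy3' : 1 + r / 4 < y.re := hy3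
    have hslopes : z.im / z.re = y.im / y.re := by
      simp only at hz
      rwa [div_left_inj' hs₁0] at hz
    have hzy : z = ((z.re / y.re : ℝ) : ℂ) * y := by
      apply Complex.ext
      · rw [Complex.re_ofReal_mul]; field_simp
      · rw [Complex.im_ofReal_mul]
        rw [div_eq_div_iff hz0.ne' hy1'.ne'] at hslopes
        field_simp
        linarith
    apply hΓD z (hNΓ z hzN)
    rw [hzy]
    exact hstar y hyD _ (by positivity) ((div_le_one hy1').2 (by linarith))
  have hNO : ∀ z ∈ frontier D, z ∈ O → z ∈ N := by
    intro z hz hzO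
    rw [← hrange] at hz
    obtain ⟨y, rfl⟩ := hz
    exact ⟨y, by rw [← hOV]; exact hzO, rfl⟩
  have h1O : (1 : ℂ) ∈ O := by
    have : x ∈ γ ⁻¹' O := by rw [hOV]; exact hxV
    rwa [mem_preimage, hx] at this
  obtain ⟨ρ, hρ, hρO⟩ := Metric.isOpen_iff.1 (hO.inter isOpen_interior) _ ⟨h1O, h1⟩
  -- separate `Γ \ {1}`
  set A : Set ℂ := {z | 0 < z.re ∧ z.re < 1 ∧ |z.im / z.re| < ρ} with hA
  set B : Set ℂ := ((fun t : ℝ => (t : ℂ)) '' Icc 0 1)ᶜ with hB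
  have hAopen : IsOpen A := by
    have h2 : IsOpen ({z : ℂ | 0 < z.re} ∩ (fun z : ℂ => z.im / z.re) ⁻¹' {s | |s| < ρ}) :=
      hslope.isOpen_inter_preimage (isOpen_lt continuous_const Complex.continuous_re)
        (isOpen_lt continuous_abs continuous_const)
    have h3 : IsOpen {z : ℂ | z.re < 1} := isOpen_lt Complex.continuous_re continuous_const
    convert h2.inter h3 using 1
    ext z
    simp only [hA, mem_ofPred_eq, mem_inter_iff, mem_preimage]
    tauto
  have hBopen : IsOpen B :=
    (isCompact_Icc.image Complex.continuous_ofReal).isClosed.isOpen_compl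
  -- Radial projection to the line `Re = 1` sends an off-axis point of `A` close to `1`. There the
  -- boundary is real, so the projection lies in `D`, and hence so does the point.
  have hAreal : ∀ z ∈ frontier D, z ∈ A → z.im = 0 := by
    rintro z hz ⟨hz0, hz1, hzρ⟩
    by_contra him
    set y : ℂ := ((z.re⁻¹ : ℝ) : ℂ) * z with hy
    have hyre : y.re = 1 := by rw [hy, Complex.re_ofReal_mul, inv_mul_cancel₀ hz0.ne']
    have hyim : y.im = z.im / z.re := by rw [hy, Complex.im_ofReal_mul, inv_mul_eq_div]
    have hyball : y ∈ ball (1 : ℂ) ρ := by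
      rw [mem_ball, dist_eq_norm]
      refine (Complex.norm_le_abs_re_add_abs_im _).trans_lt ?_
      rw [Complex.sub_re, Complex.sub_im, hyre, hyim]
      simpa using hzρ
    have hyD : y ∈ D := by
      by_contra hyD
      have := hNreal y (hNO y (hΓ y (interior_subset (hρO hyball).2) hyD) (hρO hyball).1)
      rw [hyim, div_eq_zero_iff] at this
      rcases this with h | h
      · exact him h
      · exact hz0.ne' h
    have := hstar y hyD z.re hz0.le hz1.le
    rw [hy, ← mul_assoc, ← Complex.ofReal_mul, mul_inv_cancel₀ hz0.ne', Complex.ofReal_one,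
      one_mul] at this
    exact hΓD z hz this
  have hconn : IsPreconnected (γ '' {x}ᶜ) :=
    (Circle.isPreconnected_compl_singleton x).image _ hγ.continuousOn
  have hmem : ∀ z, z ∈ γ '' {x}ᶜ ↔ z ∈ frontier D ∧ z ≠ 1 := by
    intro z
    rw [← hrange]
    constructor
    · rintro ⟨y, hy, rfl⟩
      exact ⟨mem_range_self y, fun h => hy (hinj (h.trans hx.symm))⟩
    · rintro ⟨⟨y, rfl⟩, hne⟩
      exact ⟨y, fun h => hne (by rw [mem_singleton_iff.1 h, hx]), rfl⟩
  have hcover : γ '' {x}ᶜ ⊆ A ∪ B := by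
    intro z hz
    rw [hmem] at hz
    by_cases hzB : z ∈ B
    · exact Or.inr hzB
    · left
      obtain ⟨t, ⟨ht0, ht1⟩, rfl⟩ := not_not.1 hzB
      have ht0' : t ≠ 0 := by rintro rfl; exact hΓD _ hz.1 (by simpa using h0)
      have ht1' : t ≠ 1 := by rintro rfl; exact hz.2 (by simp)
      refine ⟨by simpa using lt_of_le_of_ne ht0 ht0'.symm, by simpa using lt_of_le_of_ne ht1 ht1', ?_⟩
      simpa using hρ
  have hra : (1 + r / 2 : ℝ) ∈ Ioi (1 : ℝ) := by rw [mem_Ioi]; linarith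
  -- `A` and `B` would disconnect the curve minus the point `1`, which is connected as the image of
  -- a punctured circle: `a` lies in `A`, `1 + r / 2` in `B`, and a curve point in `A` is real,
  -- hence outside `B`.
  obtain ⟨z, hz, hzA, hzB⟩ := hconn A B hAopen hBopen hcover
    ⟨(a : ℂ), (hmem _).2 ⟨hΓ _ (by simpa using hstarcl 1 (interior_subset h1) a ha0.le ha1.le) haD,
      by exact_mod_cast ha1.ne⟩, by simpa [hA] using ⟨ha0, ha1, hρ⟩⟩
    ⟨((1 + r / 2 : ℝ) : ℂ), (hmem _).2 ⟨hΓ _ (hball (by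
      rw [mem_ball, dist_eq_norm, ← Complex.ofReal_one, ← Complex.ofReal_sub, Complex.norm_real,
        add_sub_cancel_left, Real.norm_of_nonneg (by positivity)]
      linarith)) (hray a _ ha0 (by linarith) haD), by exact_mod_cast (ne_of_gt hra)⟩, by
      rintro ⟨t, ⟨_, ht1⟩, ht⟩
      have : t = 1 + r / 2 := Complex.ofReal_injective ht
      linarith⟩
  rw [hmem] at hz
  have him := hAreal z hz.1 hzA
  exact hzB ⟨z.re, ⟨hzA.1.le, hzA.2.1.le⟩, Complex.ext (by simp) (by simp [him])⟩

/-- A star-shaped open set that is bounded by a Jordan curve is the interior of its closure. -/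
theorem StarConvex.interior_closure_subset {D : Set ℂ} (hD : IsOpen D) {c : ℂ} (hc : c ∈ D)
    (hstar : StarConvex ℝ c D) {γ : Circle → ℂ} (hγ : Continuous γ)
    (hinj : Function.Injective γ) (hrange : range γ = frontier D) : interior (closure D) ⊆ D := by
  intro w hw
  by_contra hwD
  have hwc : w - c ≠ 0 := fun h => hwD (by rwa [sub_eq_zero.1 h])
  -- Pushing `w` slightly outwards stays in the interior of the closure. The affine map sending `0`
  -- to `c` and `1` to the pushed point places `w` at `(1 + η)⁻¹ < 1`.
  obtain ⟨η, hη, hηint⟩ : ∃ η : ℝ, 0 < η ∧ c + ((1 + η : ℝ) : ℂ) * (w - c) ∈ interior (closure D) := by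
    have hcont : Continuous fun η : ℝ => c + ((1 + η : ℝ) : ℂ) * (w - c) := by fun_prop
    have hnhds := (isOpen_interior.preimage hcont).mem_nhds (x := 0) (by simpa using hw)
    obtain ⟨ε, hε, hsub⟩ := Metric.mem_nhds_iff.1 hnhds
    exact ⟨ε / 2, by positivity, hsub (by
      rw [mem_ball, dist_zero_right, Real.norm_of_nonneg (by positivity)]; linarith)⟩
  have hη1 : ((1 + η : ℝ) : ℂ) ≠ 0 := by exact_mod_cast (by positivity)
  set b : ℂ := ((1 + η : ℝ) : ℂ) * (w - c) with hb
  have hb0 : b ≠ 0 := mul_ne_zero hη1 hwc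
  set h : ℂ ≃ₜ ℂ := (Homeomorph.mulRight₀ b hb0).trans (Homeomorph.addLeft c) with hh
  have happ : ∀ z, h z = c + z * b := fun z => rfl
  refine false_of_one_mem_interior_closure (D := h ⁻¹' D) (hD.preimage h.continuous) ?_ ?_
    (γ := h.symm ∘ γ) (h.symm.continuous.comp hγ) (h.symm.injective.comp hinj) ?_
    (a := (1 + η)⁻¹) (by positivity) (inv_lt_one_of_one_lt₀ (by linarith)) ?_ ?_
  · rw [mem_preimage, happ]; simpa using hc
  · intro z hz t ht0 ht1
    rw [mem_preimage, happ] at hz ⊢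
    have := hstar hz (sub_nonneg.2 ht1) ht0 (by ring)
    simp only [Complex.real_smul] at this
    convert this using 1
    push_cast
    ring
  · rw [← h.preimage_frontier, ← hrange, range_comp, h.image_symm]
  · rw [mem_preimage, happ, hb, ← mul_assoc, ← Complex.ofReal_mul, inv_mul_cancel₀ (by positivity)]
    simpa using hwD
  · rw [← h.preimage_closure, ← h.preimage_interior, mem_preimage, happ, one_mul]
    exact hηint

end JordanStar

/-! ### Slices of an open set and of its closure -/

section Slices

open Set

/-- The plane `ℂ_I`, parametrized by the complex numbers. -/
noncomputable def sliceEmb (I : ℍ[ℝ]) (z : ℂ) : ℍ[ℝ] := slicePoint I z.re z.im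

theorem sliceEmb_eq (I : ℍ[ℝ]) (z : ℂ) : sliceEmb I z = (z.re : ℍ[ℝ]) + z.im • I := by
  rw [sliceEmb, slicePoint, Quaternion.mul_coe_eq_smul]

theorem mem_sliceSet {U : Set ℍ[ℝ]} {I : ℍ[ℝ]} {z : ℂ} : z ∈ sliceSet U I ↔ sliceEmb I z ∈ U :=
  Iff.rfl

theorem imagUnitSphere_mul_self {I : ℍ[ℝ]} (hI : I ∈ imagUnitSphere) : I * I = -1 := by
  have h2 : star I = -I := by ext <;> simp [hI.1]
  have := Quaternion.self_mul_star I
  rw [h2, Quaternion.normSq_eq_norm_mul_self, hI.2] at this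
  have h3 : -(I * I) = 1 := by simpa using this
  rw [← h3, neg_neg]

theorem neg_mem_imagUnitSphere {I : ℍ[ℝ]} (hI : I ∈ imagUnitSphere) : -I ∈ imagUnitSphere :=
  ⟨by simp [hI.1], by rw [norm_neg, hI.2]⟩

theorem continuous_sliceEmb_uncurry : Continuous fun p : ℍ[ℝ] × ℂ => sliceEmb p.1 p.2 := by
  simp only [sliceEmb_eq]
  exact (Quaternion.continuous_coe.comp (by fun_prop)).add (by fun_prop)

theorem continuous_sliceEmb (I : ℍ[ℝ]) : Continuous (sliceEmb I) :=
  continuous_sliceEmb_uncurry.comp (by fun_prop : Continuous fun z : ℂ => (I, z))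

theorem sliceEmb_neg (I : ℍ[ℝ]) (z : ℂ) : sliceEmb (-I) z = sliceEmb I (star z) := by
  simp [sliceEmb_eq]

theorem sliceEmb_ofReal (I : ℍ[ℝ]) (x : ℝ) : sliceEmb I x = (x : ℍ[ℝ]) := by
  simp [sliceEmb_eq]

theorem sliceEmb_add (I : ℍ[ℝ]) (z w : ℂ) : sliceEmb I (z + w) = sliceEmb I z + sliceEmb I w := by
  simp only [sliceEmb_eq, Complex.add_re, Complex.add_im, Quaternion.coe_add, add_smul]
  abel

theorem sliceEmb_smul (I : ℍ[ℝ]) (t : ℝ) (z : ℂ) : sliceEmb I (t * z) = t • sliceEmb I z := by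
  simp only [sliceEmb_eq, Complex.re_ofReal_mul, Complex.im_ofReal_mul, Quaternion.coe_mul,
    smul_add, mul_smul, Quaternion.coe_mul_eq_smul]

theorem sliceEmb_mul {I : ℍ[ℝ]} (hI : I ∈ imagUnitSphere) (z w : ℂ) :
    sliceEmb I (z * w) = sliceEmb I z * sliceEmb I w := by
  simp only [sliceEmb_eq, Complex.mul_re, Complex.mul_im, add_mul, mul_add,
    ← Quaternion.coe_mul_eq_smul]
  have h1 : (z.im : ℍ[ℝ]) * I * ((w.im : ℍ[ℝ]) * I) = -((z.im * w.im : ℝ) : ℍ[ℝ]) := by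
    rw [mul_assoc, ← mul_assoc I, ← Quaternion.coe_commutes, mul_assoc,
      imagUnitSphere_mul_self hI, Quaternion.coe_mul]
    simp
  have h2 : (z.im : ℍ[ℝ]) * I * (w.re : ℍ[ℝ]) = ((z.im * w.re : ℝ) : ℍ[ℝ]) * I := by
    rw [mul_assoc, ← Quaternion.coe_commutes, ← mul_assoc, Quaternion.coe_mul]
  rw [h1, h2]
  simp only [Quaternion.coe_add, Quaternion.coe_sub, Quaternion.coe_mul, add_mul, mul_assoc]
  abel

theorem sliceEmb_one (I : ℍ[ℝ]) : sliceEmb I 1 = 1 := by simp [sliceEmb_eq]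

theorem sliceEmb_pow {I : ℍ[ℝ]} (hI : I ∈ imagUnitSphere) (z : ℂ) (k : ℕ) :
    sliceEmb I (z ^ k) = sliceEmb I z ^ k := by
  induction k with
  | zero => simp [sliceEmb_one]
  | succ k ih => rw [pow_succ, pow_succ, sliceEmb_mul hI, ih]

theorem norm_sliceEmb_le {I : ℍ[ℝ]} (hI : I ∈ imagUnitSphere) (z : ℂ) :
    ‖sliceEmb I z‖ ≤ 2 * ‖z‖ := by
  rw [sliceEmb_eq]
  refine (norm_add_le _ _).trans ?_
  rw [norm_smul, hI.2, mul_one, Quaternion.norm_coe]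
  have h1 := Complex.abs_re_le_norm z
  have h2 := Complex.abs_im_le_norm z
  simp only [Real.norm_eq_abs]
  linarith

/-- The representation formula for the values of the slice embeddings. -/
theorem sliceEmb_representation {I J : ℍ[ℝ]} (hI : I ∈ imagUnitSphere) (w : ℂ) :
    sliceEmb J w = (1 / 2 : ℝ) • ((1 - J * I) * sliceEmb I w + (1 + J * I) * sliceEmb (-I) w) := by
  have hII := imagUnitSphere_mul_self hI
  have h : (1 - J * I) * sliceEmb I w + (1 + J * I) * sliceEmb (-I) w = (2 : ℝ) • sliceEmb J w := by
    simp only [sliceEmb_eq, sub_mul, add_mul, mul_add, one_mul, mul_smul_comm, mul_assoc, mul_neg,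
      smul_neg, hII, mul_one]
    module
  rw [h, smul_smul]
  norm_num

theorem sliceSet_closure_eq {U : Set ℍ[ℝ]} (hU : IsAxiallySymmetric (closure U)) {I J : ℍ[ℝ]}
    (hI : I ∈ imagUnitSphere) (hJ : J ∈ imagUnitSphere) :
    sliceSet (closure U) I = sliceSet (closure U) J :=
  Subset.antisymm (fun z hz => hU z.re z.im I hI hz J hJ) (fun z hz => hU z.re z.im J hJ hz I hI)

theorem isOpen_sliceSet {U : Set ℍ[ℝ]} (hU : IsOpen U) (I : ℍ[ℝ]) : IsOpen (sliceSet U I) :=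
  hU.preimage (continuous_sliceEmb I)

theorem closure_sliceSet_subset (U : Set ℍ[ℝ]) (I : ℍ[ℝ]) :
    closure (sliceSet U I) ⊆ sliceSet (closure U) I :=
  closure_minimal (fun _ hz => subset_closure hz)
    (isClosed_closure.preimage (continuous_sliceEmb I))

theorem starConvex_sliceSet {U : Set ℍ[ℝ]} {x₀ : ℝ} (hU : StarConvex ℝ (x₀ : ℍ[ℝ]) U) (I : ℍ[ℝ]) :
    StarConvex ℝ (x₀ : ℂ) (sliceSet U I) := by
  intro z hz a b ha hb hab
  have := hU hz ha hb hab
  rw [mem_sliceSet, Complex.real_smul, Complex.real_smul, sliceEmb_add, sliceEmb_smul,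
    sliceEmb_smul, sliceEmb_ofReal]
  exact this

theorem StarConvex.closure_of {E : Type*} [AddCommGroup E] [Module ℝ E] [TopologicalSpace E]
    [ContinuousAdd E] [ContinuousConstSMul ℝ E] {s : Set E} {x : E} (hs : StarConvex ℝ x s) :
    StarConvex ℝ x (closure s) := by
  intro z hz a b ha hb hab
  exact map_mem_closure (f := fun z => a • x + b • z) (by fun_prop) hz
    fun w hw => hs hw ha hb hab

/-- A quaternion that is not real lies in `ℂ_J` for `J = q.im / (σ ‖q.im‖)` and `σ = ±1`. -/
theorem slicePoint_normalize {q : ℍ[ℝ]} (hq : q.im ≠ 0) {σ : ℝ} (hσ : |σ| = 1) :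
    (σ * ‖q.im‖)⁻¹ • q.im ∈ imagUnitSphere ∧
      sliceEmb ((σ * ‖q.im‖)⁻¹ • q.im) ⟨q.re, σ * ‖q.im‖⟩ = q := by
  have hn : ‖q.im‖ ≠ 0 := norm_ne_zero_iff.2 hq
  have hσ0 : σ ≠ 0 := by rintro rfl; simp at hσ
  refine ⟨⟨by simp, ?_⟩, ?_⟩
  · rw [norm_smul, norm_inv, norm_mul, Real.norm_eq_abs σ, hσ, one_mul, norm_norm,
      inv_mul_cancel₀ hn]
  · rw [sliceEmb_eq, smul_smul, mul_inv_cancel₀ (mul_ne_zero hσ0 hn), one_smul,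
      Quaternion.re_add_im]

theorem imagUnitSphere_nonempty : imagUnitSphere.Nonempty := by
  obtain ⟨e, he⟩ : ∃ e : ℍ[ℝ], e = ⟨0, 1, 0, 0⟩ := ⟨_, rfl⟩
  refine ⟨e, by rw [he], ?_⟩
  have h := Quaternion.normSq_eq_norm_mul_self e
  have h1 : Quaternion.normSq e = 1 := by rw [Quaternion.normSq_def', he]; norm_num
  nlinarith [norm_nonneg e]

theorem exists_sliceEmb_eq (q : ℍ[ℝ]) : ∃ J ∈ imagUnitSphere, ∃ z, sliceEmb J z = q := by
  by_cases hq : q.im = 0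
  · obtain ⟨J, hJ⟩ := imagUnitSphere_nonempty
    refine ⟨J, hJ, q.re, ?_⟩
    rw [sliceEmb_ofReal]
    conv_rhs => rw [← Quaternion.re_add_im q, hq, add_zero]
  · obtain ⟨h1, h2⟩ := slicePoint_normalize hq (σ := 1) (by simp)
    exact ⟨_, h1, _, h2⟩

theorem isCompact_imagUnitSphere : IsCompact imagUnitSphere := by
  refine (isCompact_sphere (0 : ℍ[ℝ]) 1).of_isClosed_subset ?_ fun I hI => by simpa using hI.2
  exact (isClosed_eq Quaternion.continuous_re continuous_const).inter
    (isClosed_eq continuous_norm continuous_const)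

/-- The density argument varies the plane through a point, which is possible only off the real axis.
Nonreal points exist because `U` is open and accumulates at every point of its closure. -/
theorem exists_nonreal_mem_sliceSet_closure {U : Set ℍ[ℝ]} (hU : IsOpen U)
    (hsymm : IsAxiallySymmetric (closure U)) {I : ℍ[ℝ]} (hI : I ∈ imagUnitSphere) {V : Set ℂ}
    (hV : IsOpen V) (h : (V ∩ sliceSet (closure U) I).Nonempty) :
    ∃ z ∈ V ∩ sliceSet (closure U) I, z.im ≠ 0 := by
  obtain ⟨z, hzV, hz⟩ := h
  by_cases him : z.im = 0
  · have hcont : Continuous fun q : ℍ[ℝ] => (⟨q.re, ‖q.im‖⟩ : ℂ) := by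
      have : (fun q : ℍ[ℝ] => (⟨q.re, ‖q.im‖⟩ : ℂ)) = fun q : ℍ[ℝ] => (q.re : ℂ) + ‖q.im‖ * Complex.I := by
        funext q; apply Complex.ext <;> simp
      rw [this]
      exact (Complex.continuous_ofReal.comp Quaternion.continuous_re).add
        ((Complex.continuous_ofReal.comp Quaternion.continuous_im.norm).mul continuous_const)
    have hz0 : (⟨(sliceEmb I z).re, ‖(sliceEmb I z).im‖⟩ : ℂ) = z := by
      have : sliceEmb I z = (z.re : ℍ[ℝ]) := by rw [sliceEmb_eq, him, zero_smul, add_zero]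
      rw [this]
      apply Complex.ext <;> simp [him]
    obtain ⟨q, hqV, hqU⟩ := mem_closure_iff.1 hz _ (hV.preimage hcont) (by
      rw [mem_preimage]; change (⟨(sliceEmb I z).re, ‖(sliceEmb I z).im‖⟩ : ℂ) ∈ V; rwa [hz0])
    have hopen : IsOpen ((fun q : ℍ[ℝ] => (⟨q.re, ‖q.im‖⟩ : ℂ)) ⁻¹' V ∩ U) :=
      (hV.preimage hcont).inter hU
    -- move off the real axis inside the open set
    have hI0 : I ≠ 0 := fun h => by simpa [h] using hI.2
    obtain ⟨q', ⟨hq'V, hq'U⟩, hq'⟩ : ∃ q' ∈ (fun q : ℍ[ℝ] => (⟨q.re, ‖q.im‖⟩ : ℂ)) ⁻¹' V ∩ U,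
        q'.im ≠ 0 := by
      by_cases hq : q.im = 0
      · have hc : Continuous fun t : ℝ => q + t • I := by fun_prop
        have hn := (hopen.preimage hc).mem_nhds (x := 0) (by simpa using ⟨hqV, hqU⟩)
        obtain ⟨ε, hε, hsub⟩ := Metric.mem_nhds_iff.1 hn
        refine ⟨q + (ε / 2) • I, hsub (show ε / 2 ∈ Metric.ball 0 ε by
          rw [Metric.mem_ball, dist_zero_right, Real.norm_of_nonneg (by positivity)]; linarith), ?_⟩
        have hIim : I.im = I := by
          conv_rhs => rw [← Quaternion.re_add_im I, hI.1]
          simp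
        rw [Quaternion.im_add, hq, zero_add, Quaternion.im_smul, hIim]
        exact smul_ne_zero (half_pos hε).ne' hI0
      · exact ⟨q, ⟨hqV, hqU⟩, hq⟩
    obtain ⟨h1, h2⟩ := slicePoint_normalize hq' (σ := 1) (by simp)
    refine ⟨⟨q'.re, ‖q'.im‖⟩, ⟨hq'V, ?_⟩, by simpa using hq'⟩
    rw [sliceSet_closure_eq hsymm hI h1, mem_sliceSet]
    have : sliceEmb ((1 * ‖q'.im‖)⁻¹ • q'.im) ⟨q'.re, ‖q'.im‖⟩ = q' := by simpa using h2
    rw [this]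
    exact subset_closure hq'U
  · exact ⟨z, ⟨hzV, hz⟩, him⟩

/-- For an open set with axially symmetric closure, the slices of the closure are the closures of
the slices for a dense set of planes. -/
theorem dense_closure_sliceSet_eq {U : Set ℍ[ℝ]} (hU : IsOpen U)
    (hsymm : IsAxiallySymmetric (closure U)) : Dense {I : imagUnitSphere |
      closure (sliceSet U (I : ℍ[ℝ])) = sliceSet (closure U) (I : ℍ[ℝ])} := by
  have hcs : CompactSpace imagUnitSphere := isCompact_iff_compactSpace.1 isCompact_imagUnitSphere
  -- Baire's theorem on the compact sphere: for each of the countably many basic open sets `V`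
  -- meeting the common slice of the closure, the planes whose slice of `U` meets `V` form an open
  -- dense set.
  set S : Set (Set ℂ) := {V | V ∈ TopologicalSpace.countableBasis ℂ ∧
    ∀ I ∈ imagUnitSphere, (V ∩ sliceSet (closure U) I).Nonempty} with hS
  have hSopen : ∀ V ∈ S, IsOpen V := fun V hV => TopologicalSpace.isOpen_of_mem_countableBasis hV.1
  have hdense : Dense (⋂ V ∈ S, {I : imagUnitSphere | (V ∩ sliceSet U (I : ℍ[ℝ])).Nonempty}) := by
    refine dense_biInter_of_isOpen (fun V hV => ?_)
      ((TopologicalSpace.countable_countableBasis ℂ).mono fun V hV => hV.1) (fun V hV => ?_)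
    · have : {I : imagUnitSphere | (V ∩ sliceSet U (I : ℍ[ℝ])).Nonempty}
          = ⋃ z ∈ V, (fun I : imagUnitSphere => sliceEmb (I : ℍ[ℝ]) z) ⁻¹' U := by
        ext I
        simp only [mem_ofPred_eq, mem_iUnion, mem_preimage]
        exact ⟨fun ⟨z, hzV, hz⟩ => ⟨z, hzV, hz⟩, fun ⟨z, hzV, hz⟩ => ⟨z, hzV, hz⟩⟩
      rw [this]
      refine isOpen_biUnion fun z _ => hU.preimage ?_
      exact continuous_sliceEmb_uncurry.comp
        (by fun_prop : Continuous fun I : imagUnitSphere => ((I : ℍ[ℝ]), z))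
    · rw [dense_iff_inter_open]
      rintro _ ⟨W, hW, rfl⟩ ⟨I, hIW⟩
      have hI := I.2
      obtain ⟨z, ⟨hzV, hz⟩, him⟩ := exists_nonreal_mem_sliceSet_closure hU hsymm hI
        (hSopen V hV) (hV.2 I hI)
      have hzq : (sliceEmb (I : ℍ[ℝ]) z).re = z.re := by rw [sliceEmb_eq]; simp [hI.1]
      have hIim : (I : ℍ[ℝ]).im = I := by
        conv_rhs => rw [← Quaternion.re_add_im (I : ℍ[ℝ]), hI.1]
        simp
      have hziq : (sliceEmb (I : ℍ[ℝ]) z).im = z.im • (I : ℍ[ℝ]) := by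
        rw [sliceEmb_eq]; simp [hIim]
      have hzin : ‖(sliceEmb (I : ℍ[ℝ]) z).im‖ = |z.im| := by
        rw [hziq, norm_smul, hI.2, mul_one, Real.norm_eq_abs]
      have habs : |z.im| ≠ 0 := abs_ne_zero.2 him
      -- The sign of `z.im` selects between `J` and `-J`, so that points of `U` near `sliceEmb I z`
      -- get a plane near `I` and a coordinate near `z`.
      set σ : ℝ := z.im / |z.im| with hσ
      have hσ1 : |σ| = 1 := by rw [hσ, abs_div, abs_abs, div_self habs]
      have hσz : σ * |z.im| = z.im := by rw [hσ, div_mul_cancel₀ _ habs]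
      have hre := Quaternion.continuous_re
      have hic := Quaternion.continuous_im
      have hcJ : ContinuousAt (fun q : ℍ[ℝ] => (σ * ‖q.im‖)⁻¹ • q.im) (sliceEmb (I : ℍ[ℝ]) z) := by
        have h1 : ContinuousAt (fun q : ℍ[ℝ] => σ * ‖q.im‖) (sliceEmb (I : ℍ[ℝ]) z) :=
          (continuous_const.mul hic.norm).continuousAt
        exact (h1.inv₀ (by rw [hzin, hσz]; exact him)).smul hic.continuousAt
      have hcz : Continuous fun q : ℍ[ℝ] => (⟨q.re, σ * ‖q.im‖⟩ : ℂ) := by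
        have : (fun q : ℍ[ℝ] => (⟨q.re, σ * ‖q.im‖⟩ : ℂ))
            = fun q : ℍ[ℝ] => (q.re : ℂ) + (σ * ‖q.im‖ : ℝ) * Complex.I := by
          funext q; apply Complex.ext <;> simp
        rw [this]
        exact (Complex.continuous_ofReal.comp hre).add
          ((Complex.continuous_ofReal.comp (continuous_const.mul hic.norm)).mul continuous_const)
      have e1 : ∀ᶠ q in nhds (sliceEmb (I : ℍ[ℝ]) z), (σ * ‖q.im‖)⁻¹ • q.im ∈ W := by
        refine hcJ.eventually_mem (hW.mem_nhds ?_)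
        rw [hzin, hσz, hziq, smul_smul, inv_mul_cancel₀ him, one_smul]
        exact hIW
      have e2 : ∀ᶠ q in nhds (sliceEmb (I : ℍ[ℝ]) z), (⟨q.re, σ * ‖q.im‖⟩ : ℂ) ∈ V := by
        refine hcz.continuousAt.eventually_mem ((hSopen V hV).mem_nhds ?_)
        rw [hzin, hσz, hzq]
        exact hzV
      have e3 : ∀ᶠ q in nhds (sliceEmb (I : ℍ[ℝ]) z), q.im ≠ 0 := by
        refine hic.continuousAt.eventually_ne ?_
        rw [← norm_ne_zero_iff, hzin]; exact habs
      obtain ⟨q, hqU, hqW, hqV, hq⟩ :=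
        ((mem_closure_iff_frequently.1 hz).and_eventually (e1.and (e2.and e3))).exists
      obtain ⟨h1, h2⟩ := slicePoint_normalize hq hσ1
      exact ⟨⟨_, h1⟩, hqW, ⟨_, hqV, by rw [mem_sliceSet, h2]; exact hqU⟩⟩
  refine hdense.mono fun I hI => ?_
  refine Subset.antisymm (closure_sliceSet_subset U I) fun z hz => ?_
  rw [(TopologicalSpace.isBasis_countableBasis ℂ).mem_closure_iff]
  intro V hV hzV
  refine mem_iInter₂.1 hI V ⟨hV, fun J hJ => ⟨z, hzV, ?_⟩⟩
  rwa [sliceSet_closure_eq hsymm hJ I.2]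

end Slices

/-! ### Slice holomorphy and the representation formula -/

section Regularity

open Set

/-- Left `J`-holomorphy at a point of a quaternion valued function of a complex variable. -/
def SliceHolomorphicAt (J : ℍ[ℝ]) (H : ℂ → ℍ[ℝ]) (z : ℂ) : Prop :=
  DifferentiableAt ℝ H z ∧ fderiv ℝ H z Complex.I = J * fderiv ℝ H z 1

/-- The condition `J a = a I` says that left multiplication by `a` intertwines the complex
structures of `I` and `J`. -/
theorem SliceHolomorphicAt.mul_left {I J a : ℍ[ℝ]} (h : J * a = a * I) {H : ℂ → ℍ[ℝ]} {z : ℂ}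
    (hH : SliceHolomorphicAt I H z) : SliceHolomorphicAt J (fun w => a * H w) z := by
  have hd : HasFDerivAt (fun w => a * H w)
      ((ContinuousLinearMap.mul ℝ ℍ[ℝ] a).comp (fderiv ℝ H z)) z :=
    (ContinuousLinearMap.mul ℝ ℍ[ℝ] a).hasFDerivAt.comp z hH.1.hasFDerivAt
  refine ⟨hd.differentiableAt, ?_⟩
  rw [hd.fderiv]
  simp only [ContinuousLinearMap.comp_apply, ContinuousLinearMap.mul_apply']
  rw [hH.2, ← mul_assoc, ← mul_assoc, h]

theorem SliceHolomorphicAt.sub {J : ℍ[ℝ]} {H G : ℂ → ℍ[ℝ]} {z : ℂ}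
    (hH : SliceHolomorphicAt J H z) (hG : SliceHolomorphicAt J G z) :
    SliceHolomorphicAt J (fun w => H w - G w) z := by
  refine ⟨hH.1.sub hG.1, ?_⟩
  rw [fderiv_fun_sub hH.1 hG.1]
  simp only [_root_.sub_apply]
  rw [hH.2, hG.2, mul_sub]

/-- The complex coordinate in direction `a` for the complex structure on the quaternions that is
given by left multiplication by `J`. -/
noncomputable def sliceCoord (J a : ℍ[ℝ]) : ℍ[ℝ] →L[ℝ] ℂ :=
  Complex.ofRealCLM.comp (innerSL ℝ a)
    - (ContinuousLinearMap.mul ℝ ℂ Complex.I).comp (Complex.ofRealCLM.comp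
        ((innerSL ℝ a).comp (ContinuousLinearMap.mul ℝ ℍ[ℝ] J)))

theorem sliceCoord_apply (J a q : ℍ[ℝ]) :
    sliceCoord J a q = (inner ℝ a q : ℝ) - Complex.I * (inner ℝ a (J * q) : ℝ) := by
  simp [sliceCoord]

theorem sliceCoord_mul {J : ℍ[ℝ]} (hJ : J ∈ imagUnitSphere) (a q : ℍ[ℝ]) :
    sliceCoord J a (J * q) = Complex.I * sliceCoord J a q := by
  rw [sliceCoord_apply, sliceCoord_apply, ← mul_assoc, imagUnitSphere_mul_self hJ, neg_one_mul,
    inner_neg_right]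
  push_cast
  linear_combination ((inner ℝ a (J * q) : ℝ) : ℂ) * Complex.I_mul_I

theorem sliceCoord_re (J a q : ℍ[ℝ]) : (sliceCoord J a q).re = inner ℝ a q := by
  rw [sliceCoord_apply]; simp

/-- The real parts of the coordinates sum to `q` and the imaginary parts to `-J(Jq) = q`, hence the
factor `1 / 2`. Using a full real basis avoids choosing a unit orthogonal to `J`. -/
theorem sum_sliceEmb_sliceCoord {J : ℍ[ℝ]} (hJ : J ∈ imagUnitSphere) {ι : Type*} [Fintype ι]
    (b : OrthonormalBasis ι ℝ ℍ[ℝ]) (q : ℍ[ℝ]) :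
    (1 / 2 : ℝ) • ∑ i, sliceEmb J (sliceCoord J (b i) q) * b i = q := by
  have h1 : ∀ i, sliceEmb J (sliceCoord J (b i) q) * b i
      = inner ℝ (b i) q • b i - J * (inner ℝ (b i) (J * q) • b i) := by
    intro i
    have h2 : sliceEmb J (sliceCoord J (b i) q)
        = ((inner ℝ (b i) q : ℝ) : ℍ[ℝ]) - (inner ℝ (b i) (J * q) : ℝ) • J := by
      rw [sliceEmb_eq, sliceCoord_apply]
      simp [sub_eq_add_neg]
    rw [h2, sub_mul, Quaternion.coe_mul_eq_smul, smul_mul_assoc, mul_smul_comm]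
  simp only [h1]
  rw [Finset.sum_sub_distrib, ← Finset.mul_sum, b.sum_repr', b.sum_repr', ← mul_assoc,
    imagUnitSphere_mul_self hJ, neg_one_mul]
  module

theorem SliceHolomorphicAt.differentiableAt {J : ℍ[ℝ]} (hJ : J ∈ imagUnitSphere) (a : ℍ[ℝ])
    {H : ℂ → ℍ[ℝ]} {z : ℂ} (hH : SliceHolomorphicAt J H z) :
    DifferentiableAt ℂ (fun w => sliceCoord J a (H w)) z := by
  have hd : HasFDerivAt (fun w => sliceCoord J a (H w))
      ((sliceCoord J a).comp (fderiv ℝ H z)) z :=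
    (sliceCoord J a).hasFDerivAt.comp z hH.1.hasFDerivAt
  refine differentiableAt_complex_iff_differentiableAt_real.2 ⟨hd.differentiableAt, ?_⟩
  rw [hd.fderiv]
  simp only [ContinuousLinearMap.comp_apply]
  rw [hH.2, sliceCoord_mul hJ, smul_eq_mul]

/-- The slice embedding as a real linear map. -/
noncomputable def sliceEmbCLM (I : ℍ[ℝ]) : ℂ →L[ℝ] ℍ[ℝ] :=
  Complex.reCLM.smulRight (1 : ℍ[ℝ]) + Complex.imCLM.smulRight I

theorem sliceEmbCLM_apply (I : ℍ[ℝ]) (z : ℂ) : sliceEmbCLM I z = sliceEmb I z := by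
  rw [sliceEmb_eq, ← mul_one (z.re : ℍ[ℝ]), Quaternion.coe_mul_eq_smul]
  simp [sliceEmbCLM]

theorem IsSliceRegularOn.sliceHolomorphicAt {f : ℍ[ℝ] → ℍ[ℝ]} {U : Set ℍ[ℝ]} (hU : IsOpen U)
    (hf : IsSliceRegularOn f U) {I : ℍ[ℝ]} (hI : I ∈ imagUnitSphere) {z : ℂ}
    (hz : z ∈ sliceSet U I) : SliceHolomorphicAt I (fun w => f (sliceEmb I w)) z := by
  have hd : DifferentiableAt ℝ (fun w => f (sliceEmb I w)) z := by
    have h1 : DifferentiableAt ℝ f (sliceEmb I z) := (hf.1 _ hz).differentiableAt (hU.mem_nhds hz)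
    have h2 : DifferentiableAt ℝ (sliceEmb I) z := by
      have : sliceEmb I = sliceEmbCLM I := by funext w; rw [sliceEmbCLM_apply]
      rw [this]; exact (sliceEmbCLM I).differentiableAt
    exact h1.comp z h2
  have hx : deriv (fun s : ℝ => f (slicePoint I s z.im)) z.re
      = fderiv ℝ (fun w => f (sliceEmb I w)) z 1 := by
    have hc : HasDerivAt (fun s : ℝ => (s : ℂ) + z.im * Complex.I) 1 z.re := by
      simpa using (Complex.ofRealCLM.hasDerivAt (x := z.re)).add_const (z.im * Complex.I)
    have hd' := hd.hasFDerivAt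
    nth_rewrite 2 [← Complex.re_add_im z] at hd'
    have := hd'.comp_hasDerivAt z.re hc
    have h2 : ((fun w => f (sliceEmb I w)) ∘ fun s : ℝ => (s : ℂ) + z.im * Complex.I)
        = fun s : ℝ => f (slicePoint I s z.im) := by
      funext s; simp [sliceEmb]
    rw [h2] at this
    exact this.deriv
  have hy : deriv (fun t : ℝ => f (slicePoint I z.re t)) z.im
      = fderiv ℝ (fun w => f (sliceEmb I w)) z Complex.I := by
    have hc : HasDerivAt (fun t : ℝ => (z.re : ℂ) + t * Complex.I) Complex.I z.im := by
      simpa using ((Complex.ofRealCLM.hasDerivAt (x := z.im)).mul_const Complex.I).const_add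
        (z.re : ℂ)
    have hd' := hd.hasFDerivAt
    nth_rewrite 2 [← Complex.re_add_im z] at hd'
    have := hd'.comp_hasDerivAt z.im hc
    have h2 : ((fun w => f (sliceEmb I w)) ∘ fun t : ℝ => (z.re : ℂ) + t * Complex.I)
        = fun t : ℝ => f (slicePoint I z.re t) := by
      funext s; simp [sliceEmb]
    rw [h2] at this
    exact this.deriv
  refine ⟨hd, ?_⟩
  have h0 := hf.2 I hI z.re z.im hz
  rw [sliceDbar, hx, hy, smul_eq_zero] at h0
  have h1 := h0.resolve_left (by norm_num)
  have h2 := congrArg (fun q => I * q) h1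
  simp only [mul_add, ← mul_assoc, imagUnitSphere_mul_self hI, mul_zero, neg_one_mul] at h2
  exact (add_neg_eq_zero.1 h2).symm

theorem closure_inter_eq {X : Type*} [TopologicalSpace X] {s t K : Set X} (hs : IsOpen s)
    (hsK : closure s = K) (htK : closure t = K) : closure (s ∩ t) = K := by
  refine Subset.antisymm ((closure_mono inter_subset_left).trans hsK.subset) ?_
  rw [← hsK]
  refine closure_minimal ?_ isClosed_closure
  intro x hx
  exact hs.inter_closure ⟨hx, by rw [htK, ← hsK]; exact subset_closure hx⟩

theorem sliceSet_neg (U : Set ℍ[ℝ]) (I : ℍ[ℝ]) :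
    sliceSet U (-I) = Complex.conjCLE.toHomeomorph ⁻¹' sliceSet U I := by
  ext z
  rw [mem_sliceSet, sliceEmb_neg]
  rfl

/-- Two continuous functions on the closure of a star-shaped set that satisfy the same
Cauchy-Riemann equation and agree on the real axis are equal. -/
theorem eqOn_zero_of_sliceHolomorphic {J : ℍ[ℝ]} (hJ : J ∈ imagUnitSphere) {W : Set ℂ}
    (hW : IsOpen W) {x₀ : ℝ} (hx₀ : (x₀ : ℂ) ∈ W) (hstar : StarConvex ℝ (x₀ : ℂ) W)
    {H : ℂ → ℍ[ℝ]} (hH : ∀ z ∈ W, SliceHolomorphicAt J H z) (hreal : ∀ x : ℝ, H x = 0) :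
    EqOn H 0 W := by
  have key : ∀ a, EqOn (fun w => sliceCoord J a (H w)) 0 W := by
    intro a
    have han : AnalyticOnNhd ℂ (fun w => sliceCoord J a (H w)) W :=
      DifferentiableOn.analyticOnNhd
        (fun z hz => ((hH z hz).differentiableAt hJ a).differentiableWithinAt) hW
    refine han.eqOn_zero_of_preconnected_of_frequently_eq_zero
      (hstar.isPathConnected hx₀).isConnected.isPreconnected hx₀ ?_
    have hc : Filter.Tendsto (fun x : ℝ => (x : ℂ)) (nhdsWithin x₀ {x₀}ᶜ)
        (nhdsWithin (x₀ : ℂ) {(x₀ : ℂ)}ᶜ) := by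
      refine tendsto_nhdsWithin_of_tendsto_nhds_of_eventually_within _
        (Complex.continuous_ofReal.continuousAt.mono_left nhdsWithin_le_nhds) ?_
      filter_upwards [self_mem_nhdsWithin] with x hx h
      exact hx (Complex.ofReal_injective h)
    exact hc.frequently (Filter.Eventually.frequently
      (Filter.Eventually.of_forall fun x => by simp [hreal]))
  intro z hz
  -- The real part of the coordinate in direction `H z` is `‖H z‖²`.
  have h1 := congrArg Complex.re (key (H z) hz)
  simp only [sliceCoord_re, Pi.zero_apply, Complex.zero_re] at h1
  exact inner_self_eq_zero.1 h1

theorem SliceHolomorphicAt.const_smul {J : ℍ[ℝ]} {H : ℂ → ℍ[ℝ]} {z : ℂ}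
    (hH : SliceHolomorphicAt J H z) (c : ℝ) : SliceHolomorphicAt J (fun w => c • H w) z := by
  simp only [← Quaternion.coe_mul_eq_smul]
  exact hH.mul_left (Quaternion.coe_commutes c J).symm

/-- The representation formula for slice regular functions on the closure of a star-shaped set. -/
theorem representation_of_dense {U : Set ℍ[ℝ]} (hU : IsOpen U) {x₀ : ℝ} (hx₀ : (x₀ : ℍ[ℝ]) ∈ U)
    (hstar : StarConvex ℝ (x₀ : ℍ[ℝ]) U) (hsymm : IsAxiallySymmetric (closure U))
    {f : ℍ[ℝ] → ℍ[ℝ]} (hreg : IsSliceRegularOn f U) (hcont : ContinuousOn f (closure U))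
    {I J : ℍ[ℝ]} (hI : I ∈ imagUnitSphere) (hJ : J ∈ imagUnitSphere)
    (hIcl : closure (sliceSet U I) = sliceSet (closure U) I)
    (hJcl : closure (sliceSet U J) = sliceSet (closure U) J) {z : ℂ}
    (hz : z ∈ sliceSet (closure U) I) :
    f (sliceEmb J z) = (1 / 2 : ℝ) • ((1 - J * I) * f (sliceEmb I z)
      + (1 + J * I) * f (sliceEmb (-I) z)) := by
  have hnI := neg_mem_imagUnitSphere hI
  have hII := imagUnitSphere_mul_self hI
  have hJJ := imagUnitSphere_mul_self hJ
  set K := sliceSet (closure U) I with hK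
  have hKJ : sliceSet (closure U) J = K := sliceSet_closure_eq hsymm hJ hI
  have hKn : sliceSet (closure U) (-I) = K := sliceSet_closure_eq hsymm hnI hI
  have hncl : closure (sliceSet U (-I)) = K := by
    rw [sliceSet_neg, ← Homeomorph.preimage_closure, hIcl]
    exact (sliceSet_neg (closure U) I).symm.trans hKn
  -- On `W` all three terms of the formula are holomorphic. `W` is star-shaped about a real point,
  -- so the identity theorem applies, and it is dense in `K`.
  set W : Set ℂ := sliceSet U J ∩ (sliceSet U I ∩ sliceSet U (-I)) with hW
  have hWcl : closure W = K := closure_inter_eq (isOpen_sliceSet hU J) (hJcl.trans hKJ)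
    (closure_inter_eq (isOpen_sliceSet hU I) hIcl hncl)
  have hWopen : IsOpen W :=
    (isOpen_sliceSet hU J).inter ((isOpen_sliceSet hU I).inter (isOpen_sliceSet hU (-I)))
  have hxW : ∀ L : ℍ[ℝ], (x₀ : ℂ) ∈ sliceSet U L := fun L => by
    rw [mem_sliceSet, sliceEmb_ofReal]; exact hx₀
  have hWstar : StarConvex ℝ (x₀ : ℂ) W := (starConvex_sliceSet hstar J).inter
    ((starConvex_sliceSet hstar I).inter (starConvex_sliceSet hstar (-I)))
  set H : ℂ → ℍ[ℝ] := fun w => f (sliceEmb J w) - (1 / 2 : ℝ) • ((1 - J * I) * f (sliceEmb I w))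
    - (1 / 2 : ℝ) • ((1 + J * I) * f (sliceEmb (-I) w)) with hH
  have hHhol : ∀ w ∈ W, SliceHolomorphicAt J H w := by
    rintro w ⟨hwJ, hwI, hwn⟩
    refine ((hreg.sliceHolomorphicAt hU hJ hwJ).sub ?_).sub ?_
    -- The intertwining relation is `J(1 - JI) = I + J = (1 - JI)I`; for the other term it is `J(1 +
    -- JI) = J - I = (1 + JI)(-I)`.
    · refine SliceHolomorphicAt.const_smul
        ((hreg.sliceHolomorphicAt hU hI hwI).mul_left ?_) _
      rw [mul_sub, sub_mul, ← mul_assoc, hJJ, mul_assoc, hII]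
      simp only [mul_one, one_mul, neg_mul, mul_neg]
      abel
    · refine SliceHolomorphicAt.const_smul
        ((hreg.sliceHolomorphicAt hU hnI hwn).mul_left ?_) _
      rw [mul_add, add_mul, ← mul_assoc, hJJ, mul_assoc]
      simp only [mul_neg, hII, mul_one, one_mul, neg_mul, neg_neg]
      abel
  have hHreal : ∀ x : ℝ, H x = 0 := by
    intro x
    simp only [hH, sliceEmb_ofReal, sub_mul, add_mul, one_mul]
    module
  have hHW := eqOn_zero_of_sliceHolomorphic hJ hWopen ⟨hxW J, hxW I, hxW (-I)⟩ hWstar hHhol hHreal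
  have hsl : ∀ L, sliceSet (closure U) L = K → ContinuousOn (fun w => f (sliceEmb L w)) K :=
    fun L hL => hcont.comp (continuous_sliceEmb L).continuousOn
      (fun w hw => by rw [← hL] at hw; exact hw)
  have hHc : ContinuousOn H K := by
    have h1 := hsl J hKJ
    have h2 : ContinuousOn (fun w => (1 / 2 : ℝ) • ((1 - J * I) * f (sliceEmb I w))) K :=
      (continuousOn_const.mul (hsl I rfl)).const_smul (1 / 2 : ℝ)
    have h3 : ContinuousOn (fun w => (1 / 2 : ℝ) • ((1 + J * I) * f (sliceEmb (-I) w))) K :=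
      (continuousOn_const.mul (hsl (-I) hKn)).const_smul (1 / 2 : ℝ)
    exact (h1.sub h2).sub h3
  have hHK : EqOn H 0 K := by
    refine hHW.of_subset_closure hHc continuousOn_const ?_ hWcl.symm.subset
    rw [← hWcl]; exact subset_closure
  have := hHK hz
  simp only [hH, Pi.zero_apply] at this
  rw [sub_sub, sub_eq_zero] at this
  rw [this, smul_add]

/-- Both sides are continuous in `J` and agree for the dense set of planes covered by
`representation_of_dense`. -/
theorem representation {U : Set ℍ[ℝ]} (hU : IsOpen U) {x₀ : ℝ} (hx₀ : (x₀ : ℍ[ℝ]) ∈ U)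
    (hstar : StarConvex ℝ (x₀ : ℍ[ℝ]) U) (hsymm : IsAxiallySymmetric (closure U))
    {f : ℍ[ℝ] → ℍ[ℝ]} (hreg : IsSliceRegularOn f U) (hcont : ContinuousOn f (closure U))
    {I J : ℍ[ℝ]} (hI : I ∈ imagUnitSphere) (hJ : J ∈ imagUnitSphere)
    (hIcl : closure (sliceSet U I) = sliceSet (closure U) I) {z : ℂ}
    (hz : z ∈ sliceSet (closure U) I) :
    f (sliceEmb J z) = (1 / 2 : ℝ) • ((1 - J * I) * f (sliceEmb I z)
      + (1 + J * I) * f (sliceEmb (-I) z)) := by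
  have hcJ : Continuous fun J : imagUnitSphere => f (sliceEmb (J : ℍ[ℝ]) z) := by
    refine hcont.comp_continuous (continuous_sliceEmb_uncurry.comp
      (by fun_prop : Continuous fun J : imagUnitSphere => ((J : ℍ[ℝ]), z))) fun J => ?_
    rw [sliceSet_closure_eq hsymm hI J.2] at hz
    exact hz
  have := Continuous.ext_on (dense_closure_sliceSet_eq hU hsymm) hcJ
    (g := fun J : imagUnitSphere => (1 / 2 : ℝ) • ((1 - (J : ℍ[ℝ]) * I) * f (sliceEmb I z)
      + (1 + (J : ℍ[ℝ]) * I) * f (sliceEmb (-I) z))) (by fun_prop)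
    fun J hJ => representation_of_dense hU hx₀ hstar hsymm hreg hcont hI J.2 hIcl hJ hz
  exact congrFun this ⟨J, hJ⟩

theorem IsRightPolynomial.add_const {P : ℍ[ℝ] → ℍ[ℝ]} (hP : IsRightPolynomial P) (c : ℍ[ℝ]) :
    IsRightPolynomial fun q => P q + c := by
  obtain ⟨n, a, ha⟩ := hP
  refine ⟨n, fun k => a k + if k = 0 then c else 0, fun q => ?_⟩
  simp only [ha, mul_add, Finset.sum_add_distrib]
  congr 1
  rw [Finset.sum_eq_single 0] <;> simp +contextual

/-- Approximation on one slice by right polynomials. -/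
theorem exists_rightPolynomial_slice {I : ℍ[ℝ]} (hI : I ∈ imagUnitSphere) {K : Set ℂ}
    {H : ℂ → ℍ[ℝ]} (h : ∀ a, PolyApprox K fun z => sliceCoord I a (H z)) {ε : ℝ} (hε : 0 < ε) :
    ∃ (n : ℕ) (a : ℕ → ℍ[ℝ]), ∀ z ∈ K,
      ‖H z - ∑ k ∈ Finset.range (n + 1), sliceEmb I z ^ k * a k‖ < ε := by
  set b := stdOrthonormalBasis ℝ ℍ[ℝ]
  set N : ℝ := ((Module.finrank ℝ ℍ[ℝ] : ℕ) : ℝ) with hN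
  -- The error is `½ · N · 2ε / (N + 1) < ε`, the factor `2` coming from `norm_sliceEmb_le`.
  choose p hp using fun i => h (b i) (ε / (N + 1)) (by positivity)
  set n := Finset.univ.sup fun i => (p i).natDegree with hn
  have hdeg : ∀ i, (p i).natDegree < n + 1 := fun i =>
    Nat.lt_succ_of_le (Finset.le_sup (f := fun i => (p i).natDegree) (Finset.mem_univ i))
  refine ⟨n, fun k => (1 / 2 : ℝ) • ∑ i, sliceEmb I ((p i).coeff k) * b i, fun z hz => ?_⟩
  have h0 : sliceEmb I 0 = 0 := by simp [sliceEmb_eq]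
  have h1 : ∑ k ∈ Finset.range (n + 1), sliceEmb I z ^ k
        * ((1 / 2 : ℝ) • ∑ i, sliceEmb I ((p i).coeff k) * b i)
      = (1 / 2 : ℝ) • ∑ i, sliceEmb I ((p i).eval z) * b i := by
    have h2 : ∀ i, sliceEmb I ((p i).eval z)
        = ∑ k ∈ Finset.range (n + 1), sliceEmb I z ^ k * sliceEmb I ((p i).coeff k) := by
      intro i
      rw [Polynomial.eval_eq_sum_range' (hdeg i)]
      simp only [← sliceEmbCLM_apply, map_sum]
      refine Finset.sum_congr rfl fun k _ => ?_
      simp only [sliceEmbCLM_apply]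
      rw [mul_comm, sliceEmb_mul hI, sliceEmb_pow hI]
    simp only [h2, mul_smul_comm, Finset.mul_sum, Finset.sum_mul, ← Finset.smul_sum, mul_assoc]
    rw [Finset.sum_comm]
  rw [h1]
  nth_rewrite 1 [← sum_sliceEmb_sliceCoord hI b (H z)]
  rw [← smul_sub, ← Finset.sum_sub_distrib, norm_smul, Real.norm_of_nonneg (by norm_num)]
  have h3 : ∀ i ∈ Finset.univ, ‖sliceEmb I (sliceCoord I (b i) (H z)) * b i
      - sliceEmb I ((p i).eval z) * b i‖ ≤ 2 * (ε / (N + 1)) := by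
    intro i _
    rw [← sub_mul, norm_mul, b.norm_eq_one, mul_one]
    have h4 : sliceEmb I (sliceCoord I (b i) (H z)) - sliceEmb I ((p i).eval z)
        = sliceEmb I (sliceCoord I (b i) (H z) - (p i).eval z) := by
      simp only [← sliceEmbCLM_apply, map_sub]
    rw [h4]
    refine (norm_sliceEmb_le hI _).trans ?_
    have := hp i z hz
    linarith
  have h5 := norm_sum_le_of_le _ h3
  rw [Finset.sum_const, Finset.card_univ, Fintype.card_fin, nsmul_eq_mul, ← hN] at h5
  have h6 : N * (ε / (N + 1)) < ε := by
    rw [← mul_div_assoc, div_lt_iff₀ (by positivity)]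
    nlinarith
  linarith

end Regularity

/-! ### The approximation theorem -/

theorem mainTheorem9
    (Ω : Set ℍ[ℝ]) (hopen : IsOpen Ω) (hconn : IsConnected Ω)
    (hbdd : Bornology.IsBounded Ω)
    (hjordan : ∀ I ∈ imagUnitSphere, IsBoundedJordanRegion (sliceSet Ω I))
    (x₀ : ℝ) (hstar : StarConvex ℝ (x₀ : ℍ[ℝ]) Ω)
    (hsymm : IsAxiallySymmetric (closure Ω))
    (hcompl : IsConnected (extendedCompl (closure Ω)))
    (hslice : ∀ I ∈ imagUnitSphere, IsConnected (extendedCompl (sliceSet (closure Ω) I)))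
    (α : ℍ[ℝ]) (hα : α ∈ closure Ω)
    (f : ℍ[ℝ] → ℍ[ℝ]) (hreg : IsSliceRegularOn f Ω) (hcont : ContinuousOn f (closure Ω)) :
    ∀ ε : ℝ, 0 < ε → ∃ P : ℍ[ℝ] → ℍ[ℝ], IsRightPolynomial P ∧
      (∀ q ∈ closure Ω, ‖f q - P q‖ < ε) ∧ P α = f α := by
  intro ε hε
  have hx₀ : (x₀ : ℍ[ℝ]) ∈ Ω := by
    obtain ⟨q, hq⟩ := hconn.nonempty
    simpa using hstar hq zero_le_one le_rfl (add_zero 1)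
  have : Nonempty imagUnitSphere := imagUnitSphere_nonempty.to_subtype
  obtain ⟨⟨I, hI⟩, hIcl⟩ := (dense_closure_sliceSet_eq hopen hsymm).nonempty
  have hIcl' : closure (sliceSet Ω I) = sliceSet (closure Ω) I := hIcl
  obtain ⟨hDopen, -, hDbdd, γ, hγ, hinj, hrange⟩ := hjordan I hI
  set K := sliceSet (closure Ω) I with hK
  have hKc : IsCompact K := hIcl' ▸ hDbdd.isCompact_closure
  have hDstar := starConvex_sliceSet hstar I
  have hKstar : StarConvex ℝ (x₀ : ℂ) K := hIcl' ▸ hDstar.closure_of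
  -- Regularity is known only on `Ω`, whereas Mergelyan's theorem needs holomorphy on the whole
  -- interior of `K`.
  have hint : interior K ⊆ sliceSet Ω I := by
    rw [← hIcl']
    exact hDstar.interior_closure_subset hDopen
      (by rw [mem_sliceSet, sliceEmb_ofReal]; exact hx₀) hγ hinj hrange
  have happrox : ∀ a, PolyApprox K fun z => sliceCoord I a (f (sliceEmb I z)) := by
    intro a
    refine PolyApprox.of_starConvex hKc hKstar ?_ fun z hz => ?_
    · exact (sliceCoord I a).continuous.comp_continuousOn
        (hcont.comp (continuous_sliceEmb I).continuousOn fun z hz => hz)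
    · exact ((hreg.sliceHolomorphicAt hopen hI (hint hz)).differentiableAt hI
        a).differentiableWithinAt
  obtain ⟨n, a, ha⟩ := exists_rightPolynomial_slice hI happrox (ε := ε / 4) (by positivity)
  set P : ℍ[ℝ] → ℍ[ℝ] := fun q => ∑ k ∈ Finset.range (n + 1), q ^ k * a k with hP
  -- Powers commute with the slice embeddings, so the formula for each monomial is
  -- `sliceEmb_representation` at `z ^ k`, and the coefficients on the right do not interfere.
  have hPrep : ∀ J ∈ imagUnitSphere, ∀ z, P (sliceEmb J z) = (1 / 2 : ℝ) •
      ((1 - J * I) * P (sliceEmb I z) + (1 + J * I) * P (sliceEmb (-I) z)) := by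
    intro J hJ z
    simp only [hP, Finset.mul_sum, ← Finset.sum_add_distrib, Finset.smul_sum]
    refine Finset.sum_congr rfl fun k _ => ?_
    rw [← sliceEmb_pow hJ, ← sliceEmb_pow hI, ← sliceEmb_pow (neg_mem_imagUnitSphere hI),
      sliceEmb_representation (J := J) hI, smul_mul_assoc, add_mul, mul_assoc, mul_assoc]
  have hbound : ∀ q ∈ closure Ω, ‖f q - P q‖ < ε / 2 := by
    intro q hq
    obtain ⟨J, hJ, z, rfl⟩ := exists_sliceEmb_eq q
    have hzK : z ∈ K := by
      rw [hK, sliceSet_closure_eq hsymm hI hJ]; exact hq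
    have hzn : star z ∈ K := by
      have h : z ∈ sliceSet (closure Ω) (-I) := by
        rw [sliceSet_closure_eq hsymm (neg_mem_imagUnitSphere hI) hI]; exact hzK
      rw [mem_sliceSet, sliceEmb_neg] at h
      exact h
    have h1 := ha z hzK
    have h2 := ha (star z) hzn
    rw [← sliceEmb_neg] at h2
    have hJI : ‖J * I‖ ≤ 1 := by rw [norm_mul, hJ.2, hI.2, one_mul]
    have h3 : ‖1 - J * I‖ ≤ 2 := (norm_sub_le _ _).trans (by rw [norm_one]; linarith)
    have h4 : ‖1 + J * I‖ ≤ 2 := (norm_add_le _ _).trans (by rw [norm_one]; linarith)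
    rw [representation hopen hx₀ hstar hsymm hreg hcont hI hJ hIcl' hzK, hPrep J hJ, ← smul_sub,
      add_sub_add_comm, ← mul_sub, ← mul_sub, norm_smul, Real.norm_of_nonneg (by norm_num)]
    have h5 := norm_add_le ((1 - J * I) * (f (sliceEmb I z) - P (sliceEmb I z)))
      ((1 + J * I) * (f (sliceEmb (-I) z) - P (sliceEmb (-I) z)))
    rw [norm_mul, norm_mul] at h5
    have h6 := mul_le_mul_of_nonneg_right h3 (norm_nonneg (f (sliceEmb I z) - P (sliceEmb I z)))
    have h7 := mul_le_mul_of_nonneg_right h4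
      (norm_nonneg (f (sliceEmb (-I) z) - P (sliceEmb (-I) z)))
    linarith
  -- The correcting constant is smaller than `ε / 2`, as is the error of `P`.
  refine ⟨fun q => P q + (f α - P α), IsRightPolynomial.add_const ⟨n, a, fun q => rfl⟩ _,
    fun q hq => ?_, add_sub_cancel _ _⟩
  have h1 := norm_sub_le (f q - P q) (f α - P α)
  rw [sub_sub] at h1
  linarith [hbound q hq, hbound α hα]
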